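/- Let $H$ be a real separable Hilbert space with inner product $(\cdot,\cdot)$ and norm $|\cdot|$, and let $T>0$. There is a constant $M>0$, depending only on $T$, such that the following holds. Let $\Psi:H\to(-\infty,+\infty]$ be proper, lower semicontinuous and convex with $\partial\Psi(0)\neq\emptyset$, where $D(\Psi)=\{u:\Psi(u)<+\infty\}$, $\partial\Psi(u)=\{\xi\in H:\Psi(u)-\Psi(v)\le(\xi,u-v)\text{ for all }v\in H\}$ for $u\in D(\Psi)$, $\partial\Psi(u)=\emptyset$ otherwise, and $D(\partial\Psi)=\{u:\partial\Psi(u)\ne\emptyset\}$. Let $B:[0,T]\times H\to H$ satisfy: (i) for every $R>0$ there is a nonnegative $\alpha_R\in L^2(0,T)$ such that, for a.e. $t\in(0,T)$, $|B(t,u)-B(t,v)|\le\alpha_R(t)|u-v|$ for all $u,v\in H$ with $|u|,|v|\le R$; and there is a nonnegative $g_0\in L^2(0,T)$ with $|B(t,0)|\le g_0(t)$ for a.e. $t\in(0,T)$; (ii) for every strongly measurable $v:[0,T]\to H$, the map $t\mapsto B(t,v(t))$ is strongly measurable. For $0<S\le T$, $f\in L^2(0,T;H)$, $u_0\in H$ and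 $v_0\in\overline{D(\partial\Psi)}\cap D(\Psi)$, a strong solution on $[0,S]$ with data $(f,u_0,v_0)$ is a function $u\in H^2(0,S;H)$ (with $u,u'$ identified with their continuous representatives on $[0,S]$) for which there is a strongly measurable $\eta$ with values in $H$ such that $$u''(t)+\eta(t)+B(t,u(t))=f(t),\qquad \eta(t)\in\partial\Psi(u'(t))\qquad\text{for a.e. }t\in(0,S),$$ and $u(0)=u_0$, $u'(0)=v_0$. (a) Local well-posedness. For all $u_0\in H$, $v_0\in\overline{D(\partial\Psi)}\cap D(\Psi)$ and $f\in L^2(0,T;H)$ there are $\tilde T\in(0,T]$ and a strong solution on $[0,\tilde T]$ with data $(f,u_0,v_0)$. For every $S\in(0,T]$, any two strong solutions on $[0,S]$ with the same data coincide on $[0,S]$. (b) Global well-posedness. Suppose in addition that there is $\alpha\in L^2(0,T)$ such that, for a.e. $t\in(0,T)$, $|B(t,v)-B(t,w)|\le\alpha(t)|v-w|$ for all $v,w\in H$. Then for all $u_0\in H$, $v_0\in\overline{D(\partial\Psi)}\cap D(\Psi)$ and $f\in L^2(0,T;H)$ there is a unique strong solution on $[0,T]$ with data $(f,u_0,v_0)$.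 Moreover, if $u_1,u_2$ are strong solutions on $[0,T]$ with data $(f,u_0^1,v_0^1)$ and $(g,u_0^2,v_0^2)$, where $f,g\in L^2(0,T;H)$, $u_0^1,u_0^2\in H$ and $v_0^1,v_0^2\in\overline{D(\partial\Psi)}\cap D(\Psi)$, then $$\|u_1-u_2\|_{C([0,T];H)}^2\le M\,e^{\int_0^T\alpha(t)\,dt}\left(|u_0^1-u_0^2|^2+|v_0^1-v_0^2|^2+\|f-g\|_{L^2(0,T;H)}^2\right).$$ -/

import Mathlib

open MeasureTheory Set
open scoped ContDiff

namespace SecondOrderInclusion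

/-- Lebesgue measure on the interval `(0, S)`. -/
noncomputable abbrev intervalMeasure (S : ℝ) : Measure ℝ := volume.restrict (Ioo 0 S)

section Functional

variable {H : Type*} [NormedAddCommGroup H] [InnerProductSpace ℝ H]

/-- The effective domain `D(Ψ) = {x | Ψ x < +∞}` of an extended real valued functional. -/
def effDomain (Ψ : H → EReal) : Set H := {x | Ψ x ≠ ⊤}

/-- The subdifferential `∂Ψ(u) = {ξ | Ψ u - Ψ v ≤ (ξ, u - v) for all v}` for `u ∈ D(Ψ)`, and
the empty set for `u ∉ D(Ψ)`.  (It is used only for functionals that never take the value `-∞`,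
for which the difference `Ψ u - Ψ v` is unambiguous.) -/
def subdiff (Ψ : H → EReal) (u : H) : Set H :=
  {ξ | u ∈ effDomain Ψ ∧ ∀ v : H, Ψ u - Ψ v ≤ ((inner ℝ ξ (u - v) : ℝ) : EReal)}

/-- The domain `D(∂Ψ) = {u | ∂Ψ(u) ≠ ∅}` of the subdifferential. -/
def subdiffDomain (Ψ : H → EReal) : Set H := {u | (subdiff Ψ u).Nonempty}

/-- `Ψ : H → (-∞, +∞]` is proper, lower semicontinuous and convex, and `∂Ψ(0) ≠ ∅`. -/
structure IsDissipationPotential (Ψ : H → EReal) : Prop where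
  ne_bot : ∀ x, Ψ x ≠ ⊥
  proper : (effDomain Ψ).Nonempty
  lsc : LowerSemicontinuous Ψ
  convex : ∀ x y : H, ∀ a b : ℝ, 0 < a → 0 < b → a + b = 1 →
    Ψ (a • x + b • y) ≤ (a : EReal) * Ψ x + (b : EReal) * Ψ y
  subdiff_zero : (subdiff Ψ 0).Nonempty

end Functional

section Perturbation

variable {H : Type*} [NormedAddCommGroup H]

/-- The standing assumption on `B : [0, T] × H → H` (values of `B t` for `t ∉ [0, T]` play no
role): local Lipschitz continuity in the second variable with moduli in `L²(0, T)`, square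
integrable bound of `B(·, 0)`, and preservation of strong measurability. -/
structure IsLocallyLipschitz (T : ℝ) (B : ℝ → H → H) : Prop where
  lipschitz : ∀ R : ℝ, 0 < R → ∃ α : ℝ → ℝ, MemLp α 2 (intervalMeasure T) ∧
    (∀ᵐ t ∂(intervalMeasure T), 0 ≤ α t) ∧
    ∀ᵐ t ∂(intervalMeasure T), ∀ u ∈ Metric.closedBall (0 : H) R,
      ∀ v ∈ Metric.closedBall (0 : H) R, ‖B t u - B t v‖ ≤ α t * ‖u - v‖
  bound_zero : ∃ g : ℝ → ℝ, MemLp g 2 (intervalMeasure T) ∧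
    (∀ᵐ t ∂(intervalMeasure T), 0 ≤ g t) ∧
    ∀ᵐ t ∂(intervalMeasure T), ‖B t 0‖ ≤ g t
  measurable_comp : ∀ v : ℝ → H, AEStronglyMeasurable v (intervalMeasure T) →
    AEStronglyMeasurable (fun t => B t (v t)) (intervalMeasure T)

/-- The global Lipschitz condition with modulus `α ∈ L²(0, T)`. -/
def IsGloballyLipschitz (T : ℝ) (B : ℝ → H → H) (α : ℝ → ℝ) : Prop :=
  MemLp α 2 (intervalMeasure T) ∧
    ∀ᵐ t ∂(intervalMeasure T), ∀ v w : H, ‖B t v - B t w‖ ≤ α t * ‖v - w‖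

end Perturbation

section Solution

variable {H : Type*} [NormedAddCommGroup H] [InnerProductSpace ℝ H]

/-- `v` is a weak derivative of `u` on `(0, S)`: integration by parts holds against every smooth
scalar test function with compact support in `(0, S)`. -/
def HasWeakDeriv (S : ℝ) (u v : ℝ → H) : Prop :=
  ∀ φ : ℝ → ℝ, ContDiff ℝ ∞ φ → HasCompactSupport φ → tsupport φ ⊆ Ioo 0 S →
    ∫ t in Ioo 0 S, deriv φ t • u t = -∫ t in Ioo 0 S, φ t • v t

/-- `u ∈ H²(0, S; H)` with first and second weak derivatives `u'` and `u''`. -/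
structure IsSobolevTwo (S : ℝ) (u u' u'' : ℝ → H) : Prop where
  memLp : MemLp u 2 (intervalMeasure S)
  memLp_deriv : MemLp u' 2 (intervalMeasure S)
  memLp_deriv_two : MemLp u'' 2 (intervalMeasure S)
  weakDeriv : HasWeakDeriv S u u'
  weakDeriv_two : HasWeakDeriv S u' u''

/-- `u` is a strong solution on `[0, S]` of
`u'' + ∂Ψ(u') + B(t, u) ∋ f`, `u(0) = u₀`, `u'(0) = v₀`:
`u ∈ H²(0, S; H)`, where `u` and `u'` are identified with their continuous representatives on
`[0, S]` (so that the initial conditions make sense), and there is a strongly measurable selection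
`η` of `∂Ψ(u')` with `u'' + η + B(t, u) = f` almost everywhere. -/
def IsStrongSolution (S : ℝ) (Ψ : H → EReal) (B : ℝ → H → H) (f : ℝ → H) (u₀ v₀ : H)
    (u : ℝ → H) : Prop :=
  ∃ u' u'' η : ℝ → H, IsSobolevTwo S u u' u'' ∧
    ContinuousOn u (Icc 0 S) ∧ ContinuousOn u' (Icc 0 S) ∧
    StronglyMeasurable η ∧
    (∀ᵐ t ∂(intervalMeasure S), u'' t + η t + B t (u t) = f t) ∧
    (∀ᵐ t ∂(intervalMeasure S), η t ∈ subdiff Ψ (u' t)) ∧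
    u 0 = u₀ ∧ u' 0 = v₀

end Solution

end SecondOrderInclusion

/-!
Solutions are handled in integrated form: `u` is the primitive of `v = u'`, which is the primitive
of `u'' ∈ L²`; the lemma of du Bois-Reymond identifies this with the weak formulation.  The calculus
behind all estimates is the chain rule for primitives of integrable functions
(`IsPrimitive.comp_contDiff`) and a Gronwall inequality with integrable coefficient
(`le_mul_exp_of_le_add_integral_mul`).

*Uniqueness and stability* (`IsIntegratedSolution.norm_sub_sq_le`).  For the difference of two
solutions put `y = |u₁ - u₂|² + |u₁' - u₂'|²`.  As `∂Ψ` is monotone,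
`y' ≤ (2 + α) y + |f - g|²`, and Gronwall's inequality gives the estimate with `M = exp (2 T)`.
On bounded intervals two given solutions stay in a ball, so the local Lipschitz condition is enough
for uniqueness.

*The first order problem* `v' + ∂φ(v) ∋ h`, `v(0) ∈ D(φ)` (`ConvexPotential.exists_solution`).
After subtraction of an affine minorant the potential is nonnegative.  The Yosida approximation
`A` of `∂φ` is Lipschitz, so `v' + A v = h` is solved by a Volterra fixed point, and testing with
`A v`, the gradient of the Moreau envelope, bounds `A v` in `L²` uniformly in the regularisation
parameter.  This bound and monotonicity make the approximations converge uniformly.  To pass to the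
limit in `A v`, which is only bounded in `L²`, one uses that the approximate solutions of the
inclusion form a decreasing sequence of convex subsets of `L²` (`approxSelections`): almost minimal
elements of such sets converge strongly (`exists_tendsto_of_antitone_convex`), hence almost
everywhere along a subsequence, and the subgradient inequality survives by lower semicontinuity.

*Existence.*  If `B` is globally Lipschitz, `u ↦ u₀ + ∫ v`, where `v` solves the first order problem
with right hand side `f - B(·, u)`, is of Volterra type and has a fixed point on all of `[0, T]`
(`exists_integratedSolution`).  In the locally Lipschitz case `B(t, ·)` is composed with the
projection onto a ball with `u₀` in its interior; the solution agrees with a solution of the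
original problem until it leaves the ball.
-/

namespace SecondOrderInclusion

/-! ### Primitives of integrable functions -/

/-- `w` is, on `[0, S]`, the primitive of the integrable function `g` with initial value `w 0`,
i.e. `w` is absolutely continuous with almost everywhere derivative `g`. -/
def IsPrimitive {E : Type*} [NormedAddCommGroup E] [NormedSpace ℝ E] (S : ℝ) (w g : ℝ → E) :
    Prop :=
  Integrable g (intervalMeasure S) ∧ ∀ t ∈ Icc 0 S, w t = w 0 + ∫ s in 0..t, g s

theorem intervalIntegrable_of_integrable {E : Type*} [NormedAddCommGroup E] {S : ℝ} {g : ℝ → E}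
    (hg : Integrable g (intervalMeasure S)) {a b : ℝ} (ha : a ∈ Icc 0 S) (hb : b ∈ Icc 0 S) :
    IntervalIntegrable g volume a b := by
  have h0S : (0 : ℝ) ≤ S := ha.1.trans ha.2
  have h : IntervalIntegrable g volume 0 S :=
    (intervalIntegrable_iff_integrableOn_Ioo_of_le h0S).2 hg
  refine h.mono_set ?_
  rw [uIcc_of_le h0S]
  exact ordConnected_Icc.uIcc_subset ha hb

theorem integrable_intervalMeasure_mono {E : Type*} [NormedAddCommGroup E] {S T : ℝ} (hST : S ≤ T)
    {g : ℝ → E} (hg : Integrable g (intervalMeasure T)) : Integrable g (intervalMeasure S) :=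
  hg.mono_measure (Measure.restrict_mono (Ioo_subset_Ioo_right hST) le_rfl)

theorem memLp_intervalMeasure_mono {E : Type*} [NormedAddCommGroup E] {S T : ℝ} (hST : S ≤ T)
    {g : ℝ → E} (hg : MemLp g 2 (intervalMeasure T)) : MemLp g 2 (intervalMeasure S) :=
  hg.mono_measure (Measure.restrict_mono (Ioo_subset_Ioo_right hST) le_rfl)

theorem ae_intervalMeasure_mono {S T : ℝ} (hST : S ≤ T) {p : ℝ → Prop}
    (h : ∀ᵐ t ∂(intervalMeasure T), p t) : ∀ᵐ t ∂(intervalMeasure S), p t :=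
  ae_mono (Measure.restrict_mono (Ioo_subset_Ioo_right hST) le_rfl) h

theorem memLp_of_continuousOn {E : Type*} [NormedAddCommGroup E] {S : ℝ} {g : ℝ → E}
    (hg : ContinuousOn g (Icc 0 S)) (p : ENNReal) : MemLp g p (intervalMeasure S) := by
  obtain ⟨C, hC⟩ := isCompact_Icc.exists_bound_of_continuousOn hg
  refine MemLp.of_bound ?_ C ?_
  · exact (hg.aestronglyMeasurable_of_subset_isCompact isCompact_Icc measurableSet_Ioo
      Ioo_subset_Icc_self)
  · exact (ae_restrict_iff' measurableSet_Ioo).2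
      (ae_of_all _ fun x hx => hC x (Ioo_subset_Icc_self hx))

theorem intervalIntegral_eq_setIntegral_Ioo {E : Type*} [NormedAddCommGroup E] [NormedSpace ℝ E]
    {t : ℝ} (ht : 0 ≤ t) (g : ℝ → E) : ∫ s in 0..t, g s = ∫ s in Ioo 0 t, g s := by
  rw [intervalIntegral.integral_of_le ht, integral_Ioc_eq_integral_Ioo]

/-- An almost everywhere inequality on `(0, S)` can be integrated over `[a, b] ⊆ [0, S]`. -/
theorem intervalIntegral_mono_of_ae {S a b : ℝ} (ha : 0 ≤ a) (hab : a ≤ b) (hb : b ≤ S)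
    {f g : ℝ → ℝ} (hf : Integrable f (intervalMeasure S)) (hg : Integrable g (intervalMeasure S))
    (h : ∀ᵐ t ∂(intervalMeasure S), f t ≤ g t) : ∫ s in a..b, f s ≤ ∫ s in a..b, g s := by
  refine intervalIntegral.integral_mono_ae_restrict hab
    (intervalIntegrable_of_integrable hf ⟨ha, hab.trans hb⟩ ⟨ha.trans hab, hb⟩)
    (intervalIntegrable_of_integrable hg ⟨ha, hab.trans hb⟩ ⟨ha.trans hab, hb⟩) ?_
  rw [Measure.restrict_congr_set (Ioo_ae_eq_Icc (μ := volume) (a := a) (b := b)).symm]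
  exact ae_mono (Measure.restrict_mono (Ioo_subset_Ioo ha hb) le_rfl) h

theorem intervalIntegral_congr_of_ae {E : Type*} [NormedAddCommGroup E] [NormedSpace ℝ E]
    {S t : ℝ} (ht : t ∈ Icc 0 S) {f g : ℝ → E}
    (h : ∀ᵐ t ∂(intervalMeasure S), f t = g t) : ∫ s in 0..t, f s = ∫ s in 0..t, g s := by
  rw [intervalIntegral_eq_setIntegral_Ioo ht.1, intervalIntegral_eq_setIntegral_Ioo ht.1]
  exact integral_congr_ae (ae_intervalMeasure_mono ht.2 h)

theorem intervalIntegral_mono_right {S s t : ℝ} (hs : 0 ≤ s) (hst : s ≤ t) (ht : t ≤ S)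
    {f : ℝ → ℝ} (hf : Integrable f (intervalMeasure S))
    (h : ∀ᵐ t ∂(intervalMeasure S), 0 ≤ f t) : ∫ r in 0..s, f r ≤ ∫ r in 0..t, f r := by
  have h1 := intervalIntegral.integral_add_adjacent_intervals
    (intervalIntegrable_of_integrable hf ⟨le_rfl, hs.trans (hst.trans ht)⟩ ⟨hs, hst.trans ht⟩)
    (intervalIntegrable_of_integrable hf ⟨hs, hst.trans ht⟩ ⟨hs.trans hst, ht⟩)
  have h2 := intervalIntegral_mono_of_ae (f := fun _ => 0) hs hst ht (integrable_zero _ _ _) hf h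
  rw [intervalIntegral.integral_zero] at h2
  linarith

theorem intervalIntegral_nonneg_of_ae {S t : ℝ} (ht : t ∈ Icc 0 S)
    {f : ℝ → ℝ} (hf : Integrable f (intervalMeasure S))
    (h : ∀ᵐ t ∂(intervalMeasure S), 0 ≤ f t) : 0 ≤ ∫ r in 0..t, f r := by
  simpa using intervalIntegral_mono_right le_rfl ht.1 ht.2 hf h

/-- A map whose increments are controlled by the integral of an integrable function is absolutely
continuous. -/
theorem absolutelyContinuousOnInterval_of_dist_le {X : Type*} [PseudoMetricSpace X] {f : ℝ → X}
    {m : ℝ → ℝ} {a b : ℝ} (hab : a ≤ b) (hm : IntervalIntegrable m volume a b)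
    (h : ∀ x ∈ Icc a b, ∀ y ∈ Icc a b, x ≤ y → dist (f x) (f y) ≤ ∫ s in x..y, m s) :
    AbsolutelyContinuousOnInterval f a b := by
  have hM := hm.absolutelyContinuousOnInterval_intervalIntegral (c := a) left_mem_uIcc
  have key : ∀ x ∈ Icc a b, ∀ y ∈ Icc a b,
      dist (f x) (f y) ≤ dist (∫ s in a..x, m s) (∫ s in a..y, m s) := by
    have hint : ∀ x ∈ Icc a b, IntervalIntegrable m volume a x := fun x hx =>
      hm.mono_set (by rw [uIcc_of_le hab, uIcc_of_le hx.1]; exact Icc_subset_Icc_right hx.2)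
    have main : ∀ x ∈ Icc a b, ∀ y ∈ Icc a b, x ≤ y →
        dist (f x) (f y) ≤ dist (∫ s in a..x, m s) (∫ s in a..y, m s) := by
      intro x hx y hy hxy
      rw [dist_comm (∫ s in a..x, m s), Real.dist_eq,
        intervalIntegral.integral_interval_sub_left (hint y hy) (hint x hx)]
      exact (h x hx y hy hxy).trans (le_abs_self _)
    intro x hx y hy
    rcases le_total x y with hxy | hxy
    · exact main x hx y hy hxy
    · rw [dist_comm, dist_comm (∫ s in a..x, m s)]
      exact main y hy x hx hxy
  rw [absolutelyContinuousOnInterval_iff] at hM ⊢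
  intro ε hε
  obtain ⟨δ, hδ, hE⟩ := hM ε hε
  refine ⟨δ, hδ, fun E hEm hEd => lt_of_le_of_lt (Finset.sum_le_sum fun i hi => ?_) (hE E hEm hEd)⟩
  have := hEm.1 i hi
  rw [uIcc_of_le hab] at this
  exact key _ this.1 _ this.2

section Primitive

variable {E F : Type*} [NormedAddCommGroup E] [NormedSpace ℝ E] [NormedAddCommGroup F]
  [NormedSpace ℝ F] {S : ℝ} {w g : ℝ → E}

namespace IsPrimitive

theorem mono {S' : ℝ} (h : IsPrimitive S w g) (hS : S' ≤ S) : IsPrimitive S' w g :=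
  ⟨integrable_intervalMeasure_mono hS h.1, fun t ht => h.2 t ⟨ht.1, ht.2.trans hS⟩⟩

theorem intervalIntegrable (h : IsPrimitive S w g) {a b : ℝ} (ha : a ∈ Icc 0 S)
    (hb : b ∈ Icc 0 S) : IntervalIntegrable g volume a b :=
  intervalIntegrable_of_integrable h.1 ha hb

theorem sub_eq (h : IsPrimitive S w g) {a b : ℝ} (ha : a ∈ Icc 0 S) (hb : b ∈ Icc 0 S) :
    w b - w a = ∫ s in a..b, g s := by
  have h0 : (0 : ℝ) ∈ Icc 0 S := ⟨le_rfl, ha.1.trans ha.2⟩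
  rw [h.2 a ha, h.2 b hb, add_sub_add_left_eq_sub,
    intervalIntegral.integral_interval_sub_left (h.intervalIntegrable h0 hb)
      (h.intervalIntegrable h0 ha)]

theorem sub {w' g' : ℝ → E} (h : IsPrimitive S w g) (h' : IsPrimitive S w' g') :
    IsPrimitive S (fun t => w t - w' t) (fun t => g t - g' t) := by
  refine ⟨h.1.sub h'.1, fun t ht => ?_⟩
  have h0 : (0 : ℝ) ∈ Icc 0 S := ⟨le_rfl, ht.1.trans ht.2⟩
  rw [intervalIntegral.integral_sub (h.intervalIntegrable h0 ht) (h'.intervalIntegrable h0 ht)]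
  show w t - w' t = w 0 - w' 0 + _
  rw [h.2 t ht, h'.2 t ht]
  abel

theorem prodMk {w' g' : ℝ → F} [CompleteSpace E] [CompleteSpace F] (h : IsPrimitive S w g)
    (h' : IsPrimitive S w' g') : IsPrimitive S (fun t => (w t, w' t)) (fun t => (g t, g' t)) := by
  refine ⟨h.1.prodMk h'.1, fun t ht => ?_⟩
  have h0 : (0 : ℝ) ∈ Icc 0 S := ⟨le_rfl, ht.1.trans ht.2⟩
  have e : ∫ s in 0..t, (g s, g' s) = (∫ s in 0..t, g s, ∫ s in 0..t, g' s) := by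
    simp only [intervalIntegral.integral_of_le ht.1]
    exact integral_pair ((intervalIntegrable_iff_integrableOn_Ioc_of_le ht.1).1
      (h.intervalIntegrable h0 ht)) ((intervalIntegrable_iff_integrableOn_Ioc_of_le ht.1).1
      (h'.intervalIntegrable h0 ht))
  rw [e, Prod.mk_add_mk, ← h.2 t ht, ← h'.2 t ht]

theorem continuousOn (h : IsPrimitive S w g) : ContinuousOn w (Icc 0 S) := by
  rcases lt_or_ge S 0 with hS | hS
  · simp [Icc_eq_empty (not_le.2 hS)]
  have h1 := intervalIntegral.continuousOn_primitive_interval (μ := volume) (f := g) (a := 0)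
    (b := S) (by
      rw [uIcc_of_le hS, integrableOn_Icc_iff_integrableOn_Ioo]
      exact h.1)
  rw [uIcc_of_le hS] at h1
  exact (continuousOn_const.add h1).congr h.2

theorem ae_hasDerivAt [CompleteSpace E] (h : IsPrimitive S w g) :
    ∀ᵐ t ∂(intervalMeasure S), HasDerivAt w (g t) t := by
  rcases lt_or_ge S 0 with hS | hS
  · simp [intervalMeasure, Ioo_eq_empty (not_lt.2 hS.le)]
  have h0 : (0 : ℝ) ∈ Icc 0 S := ⟨le_rfl, hS⟩
  have h1 := (h.intervalIntegrable h0 ⟨hS, le_rfl⟩).ae_hasDerivAt_integral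
  refine (ae_restrict_iff' measurableSet_Ioo).2 (h1.mono fun t ht hts => ?_)
  rw [uIcc_of_le hS] at ht
  have h2 := (ht (Ioo_subset_Icc_self hts) 0 h0).const_add (w 0)
  refine h2.congr_of_eventuallyEq ?_
  filter_upwards [Ioo_mem_nhds hts.1 hts.2] with x hx
  exact h.2 x (Ioo_subset_Icc_self hx)

/-- The chain rule: a continuously differentiable function of a primitive is a primitive. -/
theorem comp_contDiff [CompleteSpace E] [CompleteSpace F] (h : IsPrimitive S w g) {Φ : E → F}
    (hΦ : ContDiff ℝ 1 Φ) :
    IsPrimitive S (fun t => Φ (w t)) (fun t => fderiv ℝ Φ (w t) (g t)) := by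
  have hc := h.continuousOn
  have hcompact : IsCompact (w '' Icc 0 S) := isCompact_Icc.image_of_continuousOn hc
  obtain ⟨K, hK⟩ := LocallyLipschitzOn.exists_lipschitzOnWith_of_compact hcompact
    (hΦ.locallyLipschitz.locallyLipschitzOn)
  have hΦ' : Continuous (fderiv ℝ Φ) := hΦ.continuous_fderiv one_ne_zero
  have hd : ContinuousOn (fun t => fderiv ℝ Φ (w t)) (Icc 0 S) := hΦ'.comp_continuousOn hc
  obtain ⟨C, hC⟩ := isCompact_Icc.exists_bound_of_continuousOn hd
  set d : ℝ → F := fun t => fderiv ℝ Φ (w t) (g t) with hd_def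
  have hdm : AEStronglyMeasurable d (intervalMeasure S) := by
    have h1 : AEStronglyMeasurable (fun t => fderiv ℝ Φ (w t)) (intervalMeasure S) :=
      hd.aestronglyMeasurable_of_subset_isCompact isCompact_Icc measurableSet_Ioo
        Ioo_subset_Icc_self
    exact (ContinuousLinearMap.id ℝ (E →L[ℝ] F)).aestronglyMeasurable_comp₂ h1
      h.1.aestronglyMeasurable
  have hdb : ∀ t ∈ Icc 0 S, ‖d t‖ ≤ C * ‖g t‖ := fun t ht =>
    ((fderiv ℝ Φ (w t)).le_opNorm _).trans
      (mul_le_mul_of_nonneg_right (hC t ht) (norm_nonneg _))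
  have hdi : Integrable d (intervalMeasure S) := by
    refine (h.1.norm.const_mul C).mono' hdm ?_
    exact (ae_restrict_iff' measurableSet_Ioo).2
      (ae_of_all _ fun t ht => hdb t (Ioo_subset_Icc_self ht))
  refine ⟨hdi, fun t ht => ?_⟩
  have h0 : (0 : ℝ) ∈ Icc 0 S := ⟨le_rfl, ht.1.trans ht.2⟩
  have hsub : Icc 0 t ⊆ Icc 0 S := Icc_subset_Icc_right ht.2
  have hgi := (h.intervalIntegrable h0 ht).norm
  -- both `Φ ∘ w` and the primitive of its candidate derivative are absolutely continuous
  have hac1 : AbsolutelyContinuousOnInterval (fun x => Φ (w x)) 0 t := by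
    refine absolutelyContinuousOnInterval_of_dist_le (m := fun s => K * ‖g s‖) ht.1
      (hgi.const_mul _) fun x hx y hy hxy => ?_
    refine (hK.dist_le_mul _ (mem_image_of_mem _ (hsub hx)) _ (mem_image_of_mem _ (hsub hy))).trans
      ?_
    rw [intervalIntegral.integral_const_mul, dist_comm, dist_eq_norm,
      h.sub_eq (hsub hx) (hsub hy)]
    exact mul_le_mul_of_nonneg_left (intervalIntegral.norm_integral_le_integral_norm hxy) K.2
  have hac2 : AbsolutelyContinuousOnInterval (fun x => ∫ s in 0..x, d s) 0 t := by
    refine absolutelyContinuousOnInterval_of_dist_le (m := fun s => ‖d s‖) ht.1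
      (intervalIntegrable_of_integrable hdi h0 ht).norm fun x hx y hy hxy => ?_
    rw [dist_comm, dist_eq_norm, intervalIntegral.integral_interval_sub_left
      (intervalIntegrable_of_integrable hdi h0 (hsub hy))
      (intervalIntegrable_of_integrable hdi h0 (hsub hx))]
    exact intervalIntegral.norm_integral_le_integral_norm hxy
  have hder : ∀ᵐ x, x ∈ uIcc 0 t →
      HasDerivAt ((fun x => Φ (w x)) - fun x => ∫ s in 0..x, d s) 0 x := by
    have e1 := (ae_restrict_iff' measurableSet_Ioo).1 h.ae_hasDerivAt
    have e2 := (intervalIntegrable_of_integrable hdi h0 ht).ae_hasDerivAt_integral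
    have n1 : ∀ᵐ x : ℝ, x ≠ 0 := by simp [ae_iff, measure_singleton]
    have n2 : ∀ᵐ x : ℝ, x ≠ t := by simp [ae_iff, measure_singleton]
    filter_upwards [e1, e2, n1, n2] with x h1 h2 h3 h4 hx
    have hx' := hx
    rw [uIcc_of_le ht.1] at hx'
    have hxo : x ∈ Ioo 0 S :=
      ⟨lt_of_le_of_ne hx'.1 (Ne.symm h3), (lt_of_le_of_ne hx'.2 h4).trans_le ht.2⟩
    have := (((hΦ.differentiable one_ne_zero) (w x)).hasFDerivAt.comp_hasDerivAt x (h1 hxo)).sub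
      (h2 hx 0 left_mem_uIcc)
    rw [hd_def, sub_self] at this
    exact this
  obtain ⟨c, hcc⟩ := (hac1.sub hac2).const_of_ae_hasDerivAt_zero hder
  have c0 := hcc 0 left_mem_uIcc
  have ct := hcc t right_mem_uIcc
  simp only [Pi.sub_apply, intervalIntegral.integral_same, sub_zero] at c0 ct
  simp only [c0, ← ct, sub_add_cancel]

end IsPrimitive

/-- The energy identity `|w(t)|² = |w(0)|² + 2 ∫₀ᵗ (w, w')`. -/
theorem IsPrimitive.normSq {H : Type*} [NormedAddCommGroup H] [InnerProductSpace ℝ H]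
    [CompleteSpace H] {w g : ℝ → H} (h : IsPrimitive S w g) :
    IsPrimitive S (fun t => ‖w t‖ ^ 2) (fun t => 2 * inner ℝ (w t) (g t)) := by
  have := h.comp_contDiff (Φ := fun x : H => ‖x‖ ^ 2) (contDiff_norm_sq ℝ)
  simpa [fderiv_norm_sq] using this

theorem IsPrimitive.exp {w g : ℝ → ℝ} (h : IsPrimitive S w g) :
    IsPrimitive S (fun t => Real.exp (w t)) (fun t => g t * Real.exp (w t)) := by
  simpa [fderiv_eq_smul_deriv] using h.comp_contDiff Real.contDiff_exp

theorem IsPrimitive.of_integrable {g : ℝ → E} (hg : Integrable g (intervalMeasure S)) (c : E) :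
    IsPrimitive S (fun t => c + ∫ s in 0..t, g s) g :=
  ⟨hg, fun t _ => by simp⟩

end Primitive

/-! ### Integral inequalities with integrable coefficients -/

section Gronwall

variable {S : ℝ} {k d : ℝ → ℝ}

theorem integrable_mul_continuousOn (hk : Integrable k (intervalMeasure S))
    (hd : ContinuousOn d (Icc 0 S)) : Integrable (fun t => k t * d t) (intervalMeasure S) := by
  have hdm := (memLp_of_continuousOn hd ⊤)
  obtain ⟨C, hC⟩ := isCompact_Icc.exists_bound_of_continuousOn hd
  exact hk.mul_bdd (c := C) hdm.1 ((ae_restrict_iff' measurableSet_Ioo).2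
      (ae_of_all _ fun t ht => hC t (Ioo_subset_Icc_self ht)))

theorem integral_mul_exp_primitive (hk : Integrable k (intervalMeasure S)) {t : ℝ}
    (ht : t ∈ Icc 0 S) :
    ∫ s in 0..t, k s * Real.exp (∫ r in 0..s, k r) = Real.exp (∫ r in 0..t, k r) - 1 := by
  have h := (IsPrimitive.of_integrable hk 0).exp.2 t ht
  simp only [zero_add, intervalIntegral.integral_same, Real.exp_zero] at h
  linarith

/-- In the norm weighted by `exp (-L ∫ k)`, integration against `k` contracts by the factor
`1 / L`. -/
theorem integral_mul_le_exp_weight (hk : Integrable k (intervalMeasure S))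
    (hk0 : ∀ᵐ t ∂(intervalMeasure S), 0 ≤ k t) (hd : ContinuousOn d (Icc 0 S)) {L A : ℝ}
    (hL : 0 < L) (hA : 0 ≤ A)
    (h : ∀ t ∈ Icc 0 S, d t ≤ A * Real.exp (L * ∫ r in 0..t, k r)) {t : ℝ} (ht : t ∈ Icc 0 S) :
    ∫ s in 0..t, k s * d s ≤ A / L * Real.exp (L * ∫ r in 0..t, k r) := by
  have hLk := hk.const_mul L
  have hK : ContinuousOn (fun t => Real.exp (L * ∫ r in 0..t, k r)) (Icc 0 S) := by
    have h1 := (IsPrimitive.of_integrable hk 0).continuousOn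
    simp only [zero_add] at h1
    exact Real.continuous_exp.comp_continuousOn (continuousOn_const.mul h1)
  have e := integral_mul_exp_primitive hLk ht
  simp only [intervalIntegral.integral_const_mul] at e
  have h1 : ∫ s in 0..t, k s * d s ≤
      ∫ s in 0..t, k s * (A * Real.exp (L * ∫ r in 0..s, k r)) := by
    refine intervalIntegral_mono_of_ae le_rfl ht.1 ht.2 (integrable_mul_continuousOn hk hd)
      (integrable_mul_continuousOn hk (continuousOn_const.mul hK)) ?_
    filter_upwards [hk0, ae_restrict_mem measurableSet_Ioo] with s hs hsS
    exact mul_le_mul_of_nonneg_left (h s (Ioo_subset_Icc_self hsS)) hs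
  have h2 : ∫ s in 0..t, k s * (A * Real.exp (L * ∫ r in 0..s, k r)) =
      A / L * ∫ s in 0..t, L * k s * Real.exp (L * ∫ r in 0..s, k r) := by
    rw [← intervalIntegral.integral_const_mul]
    congr 1
    ext s
    field_simp
  rw [h2, e] at h1
  refine h1.trans ?_
  have : 0 ≤ A / L := by positivity
  nlinarith

theorem nonpos_of_le_integral_mul (hk : Integrable k (intervalMeasure S))
    (hk0 : ∀ᵐ t ∂(intervalMeasure S), 0 ≤ k t) (hd : ContinuousOn d (Icc 0 S))
    (h : ∀ t ∈ Icc 0 S, d t ≤ ∫ s in 0..t, k s * d s) : ∀ t ∈ Icc 0 S, d t ≤ 0 := by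
  intro t ht
  -- the positive part of `d` satisfies the same inequality; iterating it in the weighted norm
  -- with `L = 2` halves its bound each time
  have hD : ContinuousOn (fun t => max (d t) 0) (Icc 0 S) :=
    ContinuousOn.sup hd continuousOn_const
  have hDle : ∀ t ∈ Icc 0 S, max (d t) 0 ≤ ∫ s in 0..t, k s * max (d s) 0 := by
    intro t ht
    refine max_le ((h t ht).trans ?_) ?_
    · refine intervalIntegral_mono_of_ae le_rfl ht.1 ht.2 (integrable_mul_continuousOn hk hd)
        (integrable_mul_continuousOn hk hD) ?_
      filter_upwards [hk0] with s hs
      exact mul_le_mul_of_nonneg_left (le_max_left _ _) hs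
    · refine intervalIntegral_nonneg_of_ae ht (integrable_mul_continuousOn hk hD) ?_
      filter_upwards [hk0] with s hs
      exact mul_nonneg hs (le_max_right _ _)
  obtain ⟨A, hA⟩ := isCompact_Icc.exists_bound_of_continuousOn hD
  have hA0 : 0 ≤ A := (norm_nonneg _).trans (hA t ht)
  have hK0 : ∀ t ∈ Icc 0 S, 0 ≤ ∫ r in 0..t, k r :=
    fun t ht => intervalIntegral_nonneg_of_ae ht hk hk0
  have key : ∀ n : ℕ, ∀ t ∈ Icc 0 S,
      max (d t) 0 ≤ A / 2 ^ n * Real.exp (2 * ∫ r in 0..t, k r) := by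
    intro n
    induction n with
    | zero =>
      intro t ht
      have h1 := (le_abs_self _).trans (hA t ht)
      have h2 : 1 ≤ Real.exp (2 * ∫ r in 0..t, k r) :=
        Real.one_le_exp (by linarith [hK0 t ht])
      simp only [pow_zero, div_one]
      nlinarith
    | succ n ih =>
      intro t ht
      refine (hDle t ht).trans
        ((integral_mul_le_exp_weight hk hk0 hD two_pos (by positivity) ih ht).trans_eq ?_)
      rw [pow_succ, div_div]
  have hlim : Filter.Tendsto (fun n : ℕ => A / 2 ^ n * Real.exp (2 * ∫ r in 0..t, k r))
      Filter.atTop (nhds 0) := by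
    have h1 := (tendsto_pow_atTop_nhds_zero_of_lt_one (r := (1 / 2 : ℝ)) (by norm_num)
      (by norm_num)).const_mul A |>.mul_const (Real.exp (2 * ∫ r in 0..t, k r))
    simpa [div_eq_mul_inv] using h1
  exact (le_max_left _ _).trans (ge_of_tendsto' hlim fun n => key n t ht)

/-- Gronwall's inequality in integral form with an integrable coefficient. -/
theorem le_mul_exp_of_le_add_integral_mul {y : ℝ → ℝ} (hk : Integrable k (intervalMeasure S))
    (hk0 : ∀ᵐ t ∂(intervalMeasure S), 0 ≤ k t) (hy : ContinuousOn y (Icc 0 S)) {c : ℝ}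
    (h : ∀ t ∈ Icc 0 S, y t ≤ c + ∫ s in 0..t, k s * y s) :
    ∀ t ∈ Icc 0 S, y t ≤ c * Real.exp (∫ s in 0..t, k s) := by
  have hK : ContinuousOn (fun t => Real.exp (∫ r in 0..t, k r)) (Icc 0 S) := by
    have h1 := (IsPrimitive.of_integrable hk 0).continuousOn
    simp only [zero_add] at h1
    exact Real.continuous_exp.comp_continuousOn h1
  have hcK : ContinuousOn (fun t => c * Real.exp (∫ r in 0..t, k r)) (Icc 0 S) :=
    continuousOn_const.mul hK
  -- `c exp (∫ k)` turns the inequality for `y` into an equality; compare `y` with it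
  have key := nonpos_of_le_integral_mul
      (d := fun t => y t - c * Real.exp (∫ r in 0..t, k r)) hk hk0 (hy.sub hcK) fun t ht => by
    have h0 : (0 : ℝ) ∈ Icc 0 S := ⟨le_rfl, ht.1.trans ht.2⟩
    simp only [mul_sub]
    rw [intervalIntegral.integral_sub
      (intervalIntegrable_of_integrable (integrable_mul_continuousOn hk hy) h0 ht)
      (intervalIntegrable_of_integrable (integrable_mul_continuousOn hk hcK) h0 ht)]
    simp only [mul_left_comm _ c]
    rw [intervalIntegral.integral_const_mul, integral_mul_exp_primitive hk ht]
    linarith [h t ht]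
  intro t ht
  linarith [key t ht]

/-- Banach's fixed point theorem for maps of Volterra type on `C([0, S]; E)`.  The estimate is
quadratic because differences of solutions are controlled through their squared norms; only the
values of `Φ` at functions that are continuous on `[0, S]` matter. -/
theorem exists_fixedPoint_of_volterra {E : Type*} [NormedAddCommGroup E] [CompleteSpace E]
    (hk : Integrable k (intervalMeasure S)) (hk0 : ∀ᵐ t ∂(intervalMeasure S), 0 ≤ k t)
    (hS : 0 ≤ S) (Φ : (ℝ → E) → ℝ → E)
    (hΦ : ∀ u, ContinuousOn u (Icc 0 S) → ContinuousOn (Φ u) (Icc 0 S))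
    (hest : ∀ u w, ContinuousOn u (Icc 0 S) → ContinuousOn w (Icc 0 S) → ∀ t ∈ Icc 0 S,
      ‖Φ u t - Φ w t‖ ^ 2 ≤ ∫ s in 0..t, k s * ‖u s - w s‖ ^ 2) :
    ∃ u, ContinuousOn u (Icc 0 S) ∧ ∀ t ∈ Icc 0 S, Φ u t = u t := by
  have hS0 : S ∈ Icc 0 S := ⟨hS, le_rfl⟩
  -- Picard iterates; with the weight `L = 4` the squared distances decay like `4⁻ⁿ`
  set U : ℕ → ℝ → E := fun n => Φ^[n] 0 with hU
  have hUs : ∀ n, U (n + 1) = Φ (U n) := fun n => Function.iterate_succ_apply' _ _ _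
  have hUc : ∀ n, ContinuousOn (U n) (Icc 0 S) := by
    intro n
    induction n with
    | zero => exact continuousOn_const
    | succ n ih => rw [hUs]; exact hΦ _ ih
  have hdc : ∀ n m, ContinuousOn (fun t => ‖U n t - U m t‖ ^ 2) (Icc 0 S) := fun n m =>
    ((hUc n).sub (hUc m)).norm.pow 2
  obtain ⟨A, hA⟩ := isCompact_Icc.exists_bound_of_continuousOn (hdc 0 1)
  have hA0 : 0 ≤ A := (norm_nonneg _).trans (hA S hS0)
  have hK0 : ∀ t ∈ Icc 0 S, 0 ≤ ∫ r in 0..t, k r :=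
    fun t ht => intervalIntegral_nonneg_of_ae ht hk hk0
  have key : ∀ n : ℕ, ∀ t ∈ Icc 0 S,
      ‖U n t - U (n + 1) t‖ ^ 2 ≤ A / 4 ^ n * Real.exp (4 * ∫ r in 0..t, k r) := by
    intro n
    induction n with
    | zero =>
      intro t ht
      have h1 := (le_abs_self _).trans (hA t ht)
      have h2 : 1 ≤ Real.exp (4 * ∫ r in 0..t, k r) :=
        Real.one_le_exp (by linarith [hK0 t ht])
      simp only [pow_zero, div_one]
      nlinarith
    | succ n ih =>
      intro t ht
      have h1 := hest _ _ (hUc n) (hUc (n + 1)) t ht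
      rw [← hUs, ← hUs] at h1
      refine h1.trans ?_
      refine (integral_mul_le_exp_weight hk hk0 (hdc _ _) four_pos (by positivity) ih ht).trans_eq
        ?_
      rw [pow_succ, div_div]
  set C := Real.sqrt (A * Real.exp (4 * ∫ r in 0..S, k r)) with hC
  have hgeo : ∀ t ∈ Icc 0 S, ∀ n, dist (U n t) (U (n + 1) t) ≤ C * (1 / 2) ^ n := by
    intro t ht n
    rw [dist_eq_norm]
    refine (sq_le_sq₀ (norm_nonneg _) (by positivity)).1 ?_
    refine (key n t ht).trans ?_
    have h1 : ∫ r in 0..t, k r ≤ ∫ r in 0..S, k r :=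
      intervalIntegral_mono_right ht.1 ht.2 le_rfl hk hk0
    rw [mul_pow, hC, Real.sq_sqrt (by positivity), ← pow_mul, mul_comm n 2, pow_mul]
    have h2 : Real.exp (4 * ∫ r in 0..t, k r) ≤ Real.exp (4 * ∫ r in 0..S, k r) :=
      Real.exp_le_exp.2 (by linarith)
    calc A / 4 ^ n * Real.exp (4 * ∫ r in 0..t, k r)
        ≤ A / 4 ^ n * Real.exp (4 * ∫ r in 0..S, k r) := by gcongr
      _ = A * Real.exp (4 * ∫ r in 0..S, k r) * ((1 / 2) ^ 2) ^ n := by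
        rw [show ((1 : ℝ) / 2) ^ 2 = 1 / 4 by norm_num, one_div, inv_pow]
        ring
  have hlim : ∀ t, ∃ x, t ∈ Icc 0 S → Filter.Tendsto (fun n => U n t) Filter.atTop (nhds x) := by
    intro t
    by_cases ht : t ∈ Icc 0 S
    · obtain ⟨x, hx⟩ := cauchySeq_tendsto_of_complete
        (cauchySeq_of_le_geometric (1 / 2) C (by norm_num) (hgeo t ht))
      exact ⟨x, fun _ => hx⟩
    · exact ⟨0, fun h => (ht h).elim⟩
  choose u hu using hlim
  have hdist : ∀ n, ∀ t ∈ Icc 0 S, dist (U n t) (u t) ≤ C * (1 / 2) ^ n / (1 - 1 / 2) :=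
    fun n t ht => dist_le_of_le_geometric_of_tendsto (1 / 2) C (by norm_num) (hgeo t ht) (hu t ht) n
  have hrate : Filter.Tendsto (fun n : ℕ => C * (1 / 2) ^ n / (1 - 1 / 2)) Filter.atTop
      (nhds 0) := by
    have := ((tendsto_pow_atTop_nhds_zero_of_lt_one (r := (1 / 2 : ℝ)) (by norm_num)
      (by norm_num)).const_mul C).div_const (1 - 1 / 2)
    simpa using this
  have hunif : TendstoUniformlyOn U u Filter.atTop (Icc 0 S) := by
    rw [Metric.tendstoUniformlyOn_iff]
    intro ε hε
    filter_upwards [hrate.eventually (gt_mem_nhds hε)] with n hn t ht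
    rw [dist_comm]
    exact (hdist n t ht).trans_lt hn
  have huc : ContinuousOn u (Icc 0 S) := hunif.continuousOn (Filter.Frequently.of_forall hUc)
  refine ⟨u, huc, fun t ht => ?_⟩
  have h1 : Filter.Tendsto (fun n => U (n + 1) t) Filter.atTop (nhds (Φ u t)) := by
    rw [tendsto_iff_norm_sub_tendsto_zero]
    have hb : ∀ n, ‖U (n + 1) t - Φ u t‖ ^ 2 ≤
        (C * (1 / 2) ^ n / (1 - 1 / 2)) ^ 2 * ∫ s in 0..t, k s := by
      intro n
      rw [hUs, ← intervalIntegral.integral_const_mul]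
      refine (hest _ _ (hUc n) huc t ht).trans ?_
      refine intervalIntegral_mono_of_ae le_rfl ht.1 ht.2
        (integrable_mul_continuousOn hk (((hUc n).sub huc).norm.pow 2)) (hk.const_mul _) ?_
      filter_upwards [hk0, ae_restrict_mem measurableSet_Ioo] with s hs hsS
      rw [mul_comm]
      refine mul_le_mul_of_nonneg_right (pow_le_pow_left₀ (norm_nonneg _) ?_ 2) hs
      rw [← dist_eq_norm]
      exact hdist n s (Ioo_subset_Icc_self hsS)
    have h2 : Filter.Tendsto (fun n => ‖U (n + 1) t - Φ u t‖ ^ 2) Filter.atTop (nhds 0) := by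
      refine squeeze_zero (fun n => by positivity) hb ?_
      simpa using (hrate.pow 2).mul_const (∫ s in 0..t, k s)
    simpa [Real.sqrt_sq (norm_nonneg _)] using h2.sqrt
  exact tendsto_nhds_unique h1 ((Filter.tendsto_add_atTop_iff_nat 1).2 (hu t ht))

end Gronwall

/-! ### Nested convex sets in Hilbert spaces -/

/-- From a decreasing sequence of nonempty convex sets of a Hilbert space that all meet a fixed
ball one can select a strongly convergent sequence (almost minimal elements of the sets form a
Cauchy sequence).  This replaces weak compactness. -/
theorem exists_tendsto_of_antitone_convex {X : Type*} [NormedAddCommGroup X]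
    [InnerProductSpace ℝ X] [CompleteSpace X] {C : ℕ → Set X} (hC : Antitone C)
    (hconv : ∀ n, Convex ℝ (C n)) {R : ℝ} (hR : ∀ n, ∃ x ∈ C n, ‖x‖ ^ 2 ≤ R) :
    ∃ (x : ℕ → X) (l : X), (∀ n, x n ∈ C n) ∧ Filter.Tendsto x Filter.atTop (nhds l) := by
  set q : X → ℝ := fun x => ‖x‖ ^ 2 with hq
  set d : ℕ → ℝ := fun n => sInf (q '' C n) with hd
  have hbdd : ∀ n, BddBelow (q '' C n) := fun n =>
    ⟨0, by rintro _ ⟨x, -, rfl⟩; exact sq_nonneg _⟩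
  have hne : ∀ n, (q '' C n).Nonempty := fun n => by
    obtain ⟨x, hx, -⟩ := hR n
    exact ⟨_, mem_image_of_mem _ hx⟩
  have hdm : Monotone d := fun n m hnm =>
    csInf_le_csInf (hbdd n) (hne m) (image_mono (hC hnm))
  have hdR : ∀ n, d n ≤ R := fun n => by
    obtain ⟨x, hx, hxR⟩ := hR n
    exact (csInf_le (hbdd n) (mem_image_of_mem _ hx)).trans hxR
  have hdl : ∀ n, ∀ x ∈ C n, d n ≤ ‖x‖ ^ 2 := fun n x hx =>
    csInf_le (hbdd n) (mem_image_of_mem _ hx)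
  have hex : ∀ n : ℕ, ∃ x ∈ C n, ‖x‖ ^ 2 < d n + 1 / (n + 1) := fun n => by
    obtain ⟨_, ⟨x, hx, rfl⟩, h⟩ := exists_lt_of_csInf_lt (hne n)
      (show sInf (q '' C n) < d n + 1 / ((n : ℝ) + 1) from lt_add_of_pos_right _ (by positivity))
    exact ⟨x, hx, h⟩
  choose x hxC hxd using hex
  have hdlim : CauchySeq d :=
    (tendsto_atTop_ciSup hdm ⟨R, by rintro _ ⟨n, rfl⟩; exact hdR n⟩).cauchySeq
  -- the midpoint of `x n` and `x m` lies in `C n`, so its squared norm is at least `d n`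
  have hpar : ∀ n m, n ≤ m → ‖x n - x m‖ ^ 2 ≤ 2 * (d m - d n) + 4 * (1 / (n + 1)) := by
    intro n m hnm
    have hmid := hdl n _ (hconv n (hxC n) (hC hnm (hxC m)) (a := 1 / 2) (b := 1 / 2)
      (by norm_num) (by norm_num) (by norm_num))
    rw [← smul_add, norm_smul, mul_pow] at hmid
    have hp := parallelogram_law_with_norm ℝ (x n) (x m)
    have h1 := hxd n
    have h2 := hxd m
    have h3 : (1 : ℝ) / (m + 1) ≤ 1 / (n + 1) := by
      gcongr
    norm_num at hmid
    nlinarith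
  have hcau : CauchySeq x := by
    rw [Metric.cauchySeq_iff']
    intro ε hε
    obtain ⟨N, hN⟩ := Metric.cauchySeq_iff.1 hdlim (ε ^ 2 / 4) (by positivity)
    obtain ⟨M, hM⟩ := exists_nat_one_div_lt (show 0 < ε ^ 2 / 8 by positivity)
    refine ⟨max N M, fun n hn => ?_⟩
    have h1 := hpar _ _ hn
    have h2 := hN n (le_trans (le_max_left _ _) hn) (max N M) (le_max_left _ _)
    rw [Real.dist_eq] at h2
    have h3 := (le_abs_self _).trans_lt h2
    have h4 : (1 : ℝ) / ((max N M : ℕ) + 1) ≤ 1 / (M + 1) := by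
      gcongr
      exact le_max_right _ _
    rw [dist_comm, dist_eq_norm]
    refine lt_of_pow_lt_pow_left₀ 2 hε.le ?_
    linarith
  obtain ⟨l, hl⟩ := cauchySeq_tendsto_of_complete hcau
  exact ⟨x, l, hxC, hl⟩

/-! ### Weak derivatives and primitives -/

theorem integrable_smul_of_continuous {E : Type*} [NormedAddCommGroup E] [NormedSpace ℝ E]
    {S : ℝ} {φ : ℝ → ℝ} (hφ : Continuous φ)
    {g : ℝ → E} (hg : Integrable g (intervalMeasure S)) :
    Integrable (fun t => φ t • g t) (intervalMeasure S) := by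
  obtain ⟨C, hC⟩ := (isCompact_Icc (a := 0) (b := S)).exists_bound_of_continuousOn hφ.continuousOn
  exact hg.bdd_smul C hφ.aestronglyMeasurable ((ae_restrict_iff' measurableSet_Ioo).2
      (ae_of_all _ fun t ht => hC t (Ioo_subset_Icc_self ht)))

section WeakDeriv

variable {H : Type*} [NormedAddCommGroup H] [InnerProductSpace ℝ H] [CompleteSpace H] {S : ℝ}

theorem isPrimitive_of_contDiff {φ : ℝ → ℝ} (hφ : ContDiff ℝ ∞ φ) :
    IsPrimitive S φ (deriv φ) := by
  have hc : Continuous (deriv φ) := hφ.continuous_deriv (by simp)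
  refine ⟨(memLp_of_continuousOn hc.continuousOn 1).integrable le_rfl, fun t _ => ?_⟩
  rw [intervalIntegral.integral_deriv_eq_sub
    (fun x _ => (hφ.differentiable (by simp)).differentiableAt) (hc.intervalIntegrable _ _)]
  ring

theorem IsPrimitive.hasWeakDeriv (hS : 0 ≤ S) {w g : ℝ → H} (h : IsPrimitive S w g) :
    HasWeakDeriv S w g := by
  intro φ hφ _ hsupp
  have hz : ∀ t, t ∉ Ioo 0 S → φ t = 0 := fun t ht =>
    image_eq_zero_of_notMem_tsupport fun h' => ht (hsupp h')
  have hp := (isPrimitive_of_contDiff hφ).prodMk h |>.comp_contDiff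
    (Φ := fun p : ℝ × H => p.1 • p.2) (contDiff_fst.smul contDiff_snd)
  have hd : ∀ t, fderiv ℝ (fun p : ℝ × H => p.1 • p.2) (φ t, w t) (deriv φ t, g t) =
      φ t • g t + deriv φ t • w t := fun t => by
    rw [((hasFDerivAt_fst (𝕜 := ℝ) (E := ℝ) (F := H) (p := (φ t, w t))).fun_smul
      (hasFDerivAt_snd (𝕜 := ℝ) (E := ℝ) (F := H) (p := (φ t, w t)))).fderiv]
    simp
  simp only [hd] at hp
  have hS' : φ S • w S = φ 0 • w 0 + ∫ s in 0..S, (φ s • g s + deriv φ s • w s) :=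
    hp.2 S ⟨hS, le_rfl⟩
  rw [hz 0 (by simp), hz S (by simp), zero_smul, zero_smul, zero_add,
    intervalIntegral_eq_setIntegral_Ioo hS] at hS'
  have hw : Integrable w (intervalMeasure S) :=
    (memLp_of_continuousOn h.continuousOn 1).integrable le_rfl
  rw [integral_add (integrable_smul_of_continuous hφ.continuous h.1)
    (integrable_smul_of_continuous (hφ.continuous_deriv (by simp)) hw)] at hS'
  rw [eq_neg_iff_add_eq_zero, add_comm]
  exact hS'.symm

/-- A smooth function with compact support in `(0, S)` and vanishing integral has a primitive of
the same kind. -/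
theorem exists_primitive_of_integral_eq_zero {χ : ℝ → ℝ} (hχ : ContDiff ℝ ∞ χ)
    (hc : HasCompactSupport χ) (hs : tsupport χ ⊆ Ioo 0 S) (h0 : ∫ t, χ t = 0) :
    ∃ φ : ℝ → ℝ, ContDiff ℝ ∞ φ ∧ HasCompactSupport φ ∧ tsupport φ ⊆ Ioo 0 S ∧
      deriv φ = χ := by
  rcases (tsupport χ).eq_empty_or_nonempty with he | hne
  · have hχ0 : χ = 0 := tsupport_eq_empty_iff.1 he
    exact ⟨0, contDiff_const, HasCompactSupport.zero, by simp [tsupport], by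
      rw [hχ0]; ext; simp⟩
  have hcK : IsCompact (tsupport χ) := hc
  set a := sInf (tsupport χ)
  set b := sSup (tsupport χ)
  have ha : a ∈ Ioo 0 S := hs (hcK.sInf_mem hne)
  have hb : b ∈ Ioo 0 S := hs (hcK.sSup_mem hne)
  have hK : ∀ t, t ∉ Icc a b → χ t = 0 := fun t ht => image_eq_zero_of_notMem_tsupport fun h =>
    ht ⟨csInf_le hcK.bddBelow h, le_csSup hcK.bddAbove h⟩
  have hab : a ≤ b := by
    obtain ⟨x, hx⟩ := hne
    exact (csInf_le hcK.bddBelow hx).trans (le_csSup hcK.bddAbove hx)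
  have hχi : Integrable χ := hχ.continuous.integrable_of_hasCompactSupport hc
  have hderiv : ∀ t, HasDerivAt (fun t => ∫ s in a..t, χ s) (χ t) t := fun t =>
    intervalIntegral.integral_hasDerivAt_right (hχ.continuous.intervalIntegrable _ _)
      (hχ.continuous.stronglyMeasurableAtFilter _ _) hχ.continuous.continuousAt
  have hd : deriv (fun t => ∫ s in a..t, χ s) = χ := funext fun t => (hderiv t).deriv
  have hIcc : ∀ t, t ∉ Icc a b → ∫ s in a..t, χ s = 0 := by
    intro t ht
    rcases lt_or_ge t a with h | h
    · rw [intervalIntegral.integral_symm, intervalIntegral.integral_of_le h.le,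
        integral_Ioc_eq_integral_Ioo, neg_eq_zero]
      exact setIntegral_eq_zero_of_forall_eq_zero fun x hx => hK x fun hx' =>
        absurd hx.2 (not_lt.2 hx'.1)
    · have hbt : b < t := not_le.1 fun h' => ht ⟨h, h'⟩
      rw [intervalIntegral.integral_of_le h, ← h0, ← integral_Icc_eq_integral_Ioc]
      exact setIntegral_eq_integral_of_forall_compl_eq_zero fun x hx => hK x fun hx' =>
        hx ⟨hx'.1, hx'.2.trans hbt.le⟩
  have hsupp : tsupport (fun t => ∫ s in a..t, χ s) ⊆ Icc a b :=
    closure_minimal (fun t ht => by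
      by_contra h
      exact ht (hIcc t h)) isClosed_Icc
  refine ⟨fun t => ∫ s in a..t, χ s, ?_, ?_, ?_, hd⟩
  · rw [contDiff_infty_iff_deriv]
    exact ⟨fun t => (hderiv t).differentiableAt, by rw [hd]; exact hχ⟩
  · exact isCompact_Icc.of_isClosed_subset (isClosed_tsupport _) hsupp
  · exact hsupp.trans fun x hx => ⟨ha.1.trans_le hx.1, hx.2.trans_lt hb.2⟩

/-- The lemma of du Bois-Reymond. -/
theorem eq_of_hasWeakDeriv_zero (hS : 0 < S) {z : ℝ → H} (hz : ContinuousOn z (Icc 0 S))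
    (h : ∀ φ : ℝ → ℝ, ContDiff ℝ ∞ φ → HasCompactSupport φ → tsupport φ ⊆ Ioo 0 S →
      ∫ t in Ioo 0 S, deriv φ t • z t = 0) : ∀ t ∈ Icc 0 S, z t = z 0 := by
  have hzi : Integrable z (intervalMeasure S) :=
    (memLp_of_continuousOn hz 1).integrable le_rfl
  let ρ₀ : ContDiffBump (S / 2) := ⟨S / 8, S / 4, by positivity, by linarith⟩
  set ρ : ℝ → ℝ := ρ₀.normed volume with hρ
  have hρc : ContDiff ℝ ∞ ρ := ρ₀.contDiff_normed
  have hρs : tsupport ρ ⊆ Ioo 0 S := by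
    rw [hρ, ρ₀.tsupport_normed_eq, Real.closedBall_eq_Icc]
    intro x hx
    have h1 : S / 2 - S / 4 ≤ x := hx.1
    have h2 : x ≤ S / 2 + S / 4 := hx.2
    constructor <;> linarith
  have hρi : ∫ t, ρ t = 1 := ρ₀.integral_normed
  have hρk : HasCompactSupport ρ := ρ₀.hasCompactSupport_normed
  set c : H := ∫ t in Ioo 0 S, ρ t • z t with hc
  have hae : ∀ᵐ t ∂volume, t ∈ Ioo 0 S → z t - c = 0 := by
    refine isOpen_Ioo.ae_eq_zero_of_integral_contDiff_smul_eq_zero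
      (IntegrableOn.locallyIntegrableOn (hzi.sub (integrable_const c))) fun ψ hψ hψk hψs => ?_
    -- `ψ - (∫ ψ) ρ` has integral zero, hence is the derivative of a test function
    set I := ∫ t, ψ t with hI
    have hψi : Integrable ψ := hψ.continuous.integrable_of_hasCompactSupport hψk
    have hρint : Integrable ρ := hρc.continuous.integrable_of_hasCompactSupport hρk
    have hχk : HasCompactSupport (fun t => ψ t - I * ρ t) :=
      hψk.sub (hρk.mul_left (f := fun _ => I))
    obtain ⟨φ, hφ, hφk, hφs, hφd⟩ := exists_primitive_of_integral_eq_zero (S := S)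
      (χ := fun t => ψ t - I * ρ t) (hψ.sub (contDiff_const.mul hρc)) hχk
      ((tsupport_sub _ _).trans (union_subset hψs
        ((tsupport_mul_subset_right (f := fun _ => I)).trans hρs)))
      (by rw [integral_sub hψi (hρint.const_mul I), integral_const_mul, hρi]; simp [hI])
    have h1 := h φ hφ hφk hφs
    rw [hφd] at h1
    have e1 := integrable_smul_of_continuous hψ.continuous hzi
    have e2 := integrable_smul_of_continuous hρc.continuous hzi
    have e2' : Integrable (fun t => I • ρ t • z t) (intervalMeasure S) := e2.smul I
    simp only [sub_smul, mul_smul] at h1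
    rw [integral_sub e1 e2', integral_smul, ← hc, sub_eq_zero] at h1
    have e3 : ∫ t in Ioo 0 S, ψ t = I := setIntegral_eq_integral_of_forall_compl_eq_zero
      fun x hx => image_eq_zero_of_notMem_tsupport fun h => hx (hψs h)
    rw [← setIntegral_eq_integral_of_forall_compl_eq_zero (s := Ioo 0 S)
      fun x hx => by rw [image_eq_zero_of_notMem_tsupport fun h => hx (hψs h), zero_smul]]
    simp only [smul_sub]
    rw [integral_sub e1 (integrable_smul_of_continuous hψ.continuous (integrable_const c)), h1,
      integral_smul_const, e3, sub_self]
  have hEq : EqOn z (fun _ => c) (Icc 0 S) := by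
    refine Measure.eqOn_Icc_of_ae_eq volume hS.ne ?_ hz continuousOn_const
    rw [Measure.restrict_congr_set (Ioo_ae_eq_Icc (μ := volume) (a := 0) (b := S)).symm]
    refine (ae_restrict_iff' measurableSet_Ioo).2 (hae.mono fun t ht hts => ?_)
    exact sub_eq_zero.1 (ht hts)
  intro t ht
  rw [hEq ht, hEq ⟨le_rfl, hS.le⟩]

theorem HasWeakDeriv.isPrimitive (hS : 0 < S) {w g : ℝ → H} (h : HasWeakDeriv S w g)
    (hw : ContinuousOn w (Icc 0 S)) (hg : Integrable g (intervalMeasure S)) :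
    IsPrimitive S w g := by
  have hG := IsPrimitive.of_integrable hg (0 : H)
  have hGw := hG.hasWeakDeriv hS.le
  have hwi : Integrable w (intervalMeasure S) :=
    (memLp_of_continuousOn hw 1).integrable le_rfl
  have hGi : Integrable (fun t => 0 + ∫ s in 0..t, g s) (intervalMeasure S) :=
    (memLp_of_continuousOn hG.continuousOn 1).integrable le_rfl
  refine ⟨hg, fun t ht => ?_⟩
  have key := eq_of_hasWeakDeriv_zero hS (hw.sub hG.continuousOn) (fun φ hφ hφk hφs => by
    have hφc : Continuous (deriv φ) := hφ.continuous_deriv (by simp)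
    simp only [Pi.sub_apply, smul_sub]
    rw [integral_sub (integrable_smul_of_continuous hφc hwi)
      (integrable_smul_of_continuous hφc hGi), h φ hφ hφk hφs, hGw φ hφ hφk hφs, sub_self]) t ht
  simp only [Pi.sub_apply, zero_add, intervalIntegral.integral_same, sub_zero] at key
  rw [← key, sub_add_cancel]

end WeakDeriv

/-! ### Convex potentials, resolvents and Yosida approximation -/

section ConvexPotential

variable {H : Type*} [NormedAddCommGroup H] [InnerProductSpace ℝ H]

/-- A nonnegative proper lower semicontinuous convex functional, encoded by its effective domain
`D` and its real values on `D`; lower semicontinuity is closedness of the epigraph. -/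
structure ConvexPotential (D : Set H) (φ : H → ℝ) : Prop where
  convexOn : ConvexOn ℝ D φ
  nonneg : ∀ x ∈ D, 0 ≤ φ x
  nonempty : D.Nonempty
  isClosed : IsClosed {p : H × ℝ | p.1 ∈ D ∧ φ p.1 ≤ p.2}

/-- The subdifferential of a functional with domain `D` and real values `φ` on `D`. -/
def realSubdiff (D : Set H) (φ : H → ℝ) (x : H) : Set H :=
  {ξ | x ∈ D ∧ ∀ z ∈ D, φ x ≤ φ z + inner ℝ ξ (x - z)}

variable {D : Set H} {φ : H → ℝ}

theorem inner_sub_nonneg_of_mem_realSubdiff {x y ξ ζ : H} (hξ : ξ ∈ realSubdiff D φ x)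
    (hζ : ζ ∈ realSubdiff D φ y) : 0 ≤ inner ℝ (ξ - ζ) (x - y) := by
  have h1 := hξ.2 y hζ.1
  have h2 := hζ.2 x hξ.1
  rw [← neg_sub x y, inner_neg_right] at h2
  rw [inner_sub_left]
  linarith

/-- Minimising `y ↦ φ y + |y - x|² / (2 l)` shows that `1 + l ∂φ` is onto. -/
theorem ConvexPotential.exists_resolvent [CompleteSpace H] (h : ConvexPotential D φ) {l : ℝ}
    (hl : 0 < l) (x : H) : ∃ y, l⁻¹ • (x - y) ∈ realSubdiff D φ y := by
  set G : H → ℝ := fun y => φ y + (2 * l)⁻¹ * dist y x ^ 2 with hG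
  have hGconv : ConvexOn ℝ D G := by
    have h1 : ConvexOn ℝ univ (fun y => dist y x ^ 2) :=
      (convexOn_univ_dist (E := H) x).pow (fun _ _ => dist_nonneg) 2
    exact h.convexOn.add (((h1.smul (c := (2 * l)⁻¹) (by positivity))).subset (subset_univ _)
      h.convexOn.1)
  have hG0 : ∀ y ∈ D, 0 ≤ G y := fun y hy => add_nonneg (h.nonneg y hy) (by positivity)
  have hbdd : BddBelow (G '' D) := ⟨0, by rintro _ ⟨y, hy, rfl⟩; exact hG0 y hy⟩
  set m := sInf (G '' D) with hm
  have hmle : ∀ y ∈ D, m ≤ G y := fun y hy => csInf_le hbdd (mem_image_of_mem _ hy)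
  -- the sublevel sets close to the infimum are convex and nested
  obtain ⟨y, y₀, hyC, hy₀⟩ := exists_tendsto_of_antitone_convex
    (C := fun n : ℕ => {y ∈ D | G y ≤ m + 1 / (n + 1)})
    (fun n k hnk z hz => ⟨hz.1, hz.2.trans (by gcongr)⟩)
    (fun n => hGconv.convex_le _) (R := 2 * ‖x‖ ^ 2 + 2 * (2 * l * (m + 1))) (fun n => by
      obtain ⟨_, ⟨z, hz, rfl⟩, hlt⟩ := exists_lt_of_csInf_lt (h.nonempty.image G)
        (show sInf (G '' D) < m + 1 / ((n : ℝ) + 1) from lt_add_of_pos_right _ (by positivity))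
      refine ⟨z, ⟨hz, hlt.le⟩, ?_⟩
      have h1 : (1 : ℝ) / (n + 1) ≤ 1 := by
        rw [div_le_one (by positivity)]
        linarith [n.cast_nonneg (α := ℝ)]
      have h2 : (2 * l)⁻¹ * dist z x ^ 2 ≤ m + 1 := by
        have := h.nonneg z hz
        simp only [hG] at hlt
        linarith
      rw [inv_mul_le_iff₀ (by positivity), dist_eq_norm] at h2
      have h3 := parallelogram_law_with_norm ℝ x (z - x)
      rw [add_sub_cancel] at h3
      nlinarith [sq_nonneg ‖x - (z - x)‖])
  have hmin : y₀ ∈ D ∧ φ y₀ ≤ m - (2 * l)⁻¹ * dist y₀ x ^ 2 := by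
    have hlim : Filter.Tendsto
        (fun n : ℕ => (y n, m + 1 / ((n : ℝ) + 1) - (2 * l)⁻¹ * dist (y n) x ^ 2))
        Filter.atTop (nhds (y₀, m + 0 - (2 * l)⁻¹ * dist y₀ x ^ 2)) :=
      hy₀.prodMk_nhds ((tendsto_const_nhds.add tendsto_one_div_add_atTop_nhds_zero_nat).sub
        (((hy₀.dist tendsto_const_nhds).pow 2).const_mul _))
    rw [add_zero] at hlim
    refine h.isClosed.mem_of_tendsto hlim (Filter.Eventually.of_forall fun n => ⟨(hyC n).1, ?_⟩)
    have := (hyC n).2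
    simp only [hG] at this ⊢
    linarith
  refine ⟨y₀, hmin.1, fun z hz => ?_⟩
  -- compare the minimiser with the points `y₀ + s (z - y₀)` as `s → 0`
  have key : ∀ s ∈ Ioo (0 : ℝ) 1,
      φ y₀ ≤ φ z + inner ℝ (l⁻¹ • (x - y₀)) (y₀ - z) + s * ((2 * l)⁻¹ * ‖z - y₀‖ ^ 2) := by
    intro s hs
    have hs1 : 0 ≤ 1 - s := by linarith [hs.2]
    have hmem := h.convexOn.1 hmin.1 hz hs1 hs.1.le (by ring)
    have h1 := h.convexOn.2 hmin.1 hz hs1 hs.1.le (by ring)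
    have h2 := hmle _ hmem
    have e : (1 - s) • y₀ + s • z - x = (y₀ - x) + s • (z - y₀) := by module
    simp only [hG, dist_eq_norm, e, smul_eq_mul] at h1 h2 hmin
    rw [norm_add_sq_real, inner_smul_right, norm_smul, Real.norm_of_nonneg hs.1.le] at h2
    have h3 : inner ℝ (l⁻¹ • (x - y₀)) (y₀ - z) = l⁻¹ * inner ℝ (y₀ - x) (z - y₀) := by
      rw [inner_smul_left, ← neg_sub y₀ x, ← neg_sub z y₀, inner_neg_neg]
      simp
    rw [h3]
    have h4 : s * φ y₀ ≤ s * (φ z + l⁻¹ * inner ℝ (y₀ - x) (z - y₀) +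
        s * ((2 * l)⁻¹ * ‖z - y₀‖ ^ 2)) := by
      have h5 : (2 * l)⁻¹ * (‖y₀ - x‖ ^ 2 + 2 * (s * inner ℝ (y₀ - x) (z - y₀)) +
          (s * ‖z - y₀‖) ^ 2) = (2 * l)⁻¹ * ‖y₀ - x‖ ^ 2 + s * (l⁻¹ * inner ℝ (y₀ - x) (z - y₀)) +
          s * (s * ((2 * l)⁻¹ * ‖z - y₀‖ ^ 2)) := by
        field_simp
      rw [h5] at h2
      linarith [hmin.2]
    exact le_of_mul_le_mul_left h4 hs.1
  have hlim : Filter.Tendsto (fun s : ℝ => φ z + inner ℝ (l⁻¹ • (x - y₀)) (y₀ - z) +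
      s * ((2 * l)⁻¹ * ‖z - y₀‖ ^ 2)) (nhdsWithin 0 (Ioi 0))
      (nhds (φ z + inner ℝ (l⁻¹ • (x - y₀)) (y₀ - z) + 0 * ((2 * l)⁻¹ * ‖z - y₀‖ ^ 2))) :=
    (tendsto_const_nhds.add (Filter.tendsto_id.mul_const _)).mono_left nhdsWithin_le_nhds
  rw [zero_mul, add_zero] at hlim
  exact ge_of_tendsto hlim (Filter.mem_of_superset (Ioo_mem_nhdsGT one_pos) key)

/-- `J` is the resolvent `(1 + l ∂φ)⁻¹`, characterised by `(x - J x) / l ∈ ∂φ (J x)`. -/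
def IsResolvent (D : Set H) (φ : H → ℝ) (l : ℝ) (J : H → H) : Prop :=
  ∀ x, l⁻¹ • (x - J x) ∈ realSubdiff D φ (J x)

/-- The Yosida approximation `(x - J x) / l` of `∂φ` belonging to the resolvent `J`. -/
noncomputable def yosida (l : ℝ) (J : H → H) (x : H) : H := l⁻¹ • (x - J x)

/-- The Moreau envelope `φ (J x) + l |(x - J x) / l|² / 2` belonging to the resolvent `J`. -/
noncomputable def moreau (φ : H → ℝ) (l : ℝ) (J : H → H) (x : H) : ℝ :=
  φ (J x) + l / 2 * ‖yosida l J x‖ ^ 2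

variable {l : ℝ} {J : H → H}

theorem resolvent_add_yosida (hl : 0 < l) (J : H → H) (x : H) : J x = x - l • yosida l J x := by
  rw [yosida, smul_inv_smul₀ hl.ne', sub_sub_cancel]

namespace IsResolvent

theorem norm_yosida_sub_le (hl : 0 < l) (hJ : IsResolvent D φ l J) (x y : H) :
    ‖yosida l J x - yosida l J y‖ ≤ l⁻¹ * ‖x - y‖ := by
  have h1 : 0 ≤ inner ℝ (yosida l J x - yosida l J y) (J x - J y) :=
    inner_sub_nonneg_of_mem_realSubdiff (hJ x) (hJ y)
  have e : J x - J y = (x - y) - l • (yosida l J x - yosida l J y) := by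
    rw [resolvent_add_yosida hl J x, resolvent_add_yosida hl J y, smul_sub]
    abel
  rw [e, inner_sub_right, inner_smul_right, real_inner_self_eq_norm_sq] at h1
  have h2 := real_inner_le_norm (yosida l J x - yosida l J y) (x - y)
  rw [inv_mul_eq_div, le_div_iff₀ hl]
  by_contra hcon
  push Not at hcon
  have h3 : 0 < ‖yosida l J x - yosida l J y‖ := by
    by_contra h0
    have : ‖yosida l J x - yosida l J y‖ = 0 := le_antisymm (not_lt.1 h0) (norm_nonneg _)
    rw [this, zero_mul] at hcon
    exact absurd hcon (not_lt.2 (norm_nonneg _))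
  nlinarith

theorem continuous_yosida (hl : 0 < l) (hJ : IsResolvent D φ l J) : Continuous (yosida l J) := by
  refine (LipschitzWith.of_dist_le_mul (K := ⟨l⁻¹, by positivity⟩) fun x y => ?_).continuous
  rw [dist_eq_norm, dist_eq_norm]
  exact hJ.norm_yosida_sub_le hl x y

/-- The Yosida approximation is a subgradient of the Moreau envelope.  Exchanging `x` and `y`
bounds the increment of the envelope from above as well. -/
theorem inner_le_moreau_sub (hl : 0 < l) (hJ : IsResolvent D φ l J) (x y : H) :
    inner ℝ (yosida l J x) (y - x) ≤ moreau φ l J y - moreau φ l J x := by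
  have h1 : φ (J x) ≤ φ (J y) + inner ℝ (yosida l J x) (J x - J y) := (hJ x).2 _ (hJ y).1
  have e : J x - J y = (x - y) - l • (yosida l J x - yosida l J y) := by
    rw [resolvent_add_yosida hl J x, resolvent_add_yosida hl J y, smul_sub]
    abel
  rw [e, inner_sub_right, inner_smul_right, inner_sub_right _ (yosida l J x),
    real_inner_self_eq_norm_sq] at h1
  have h2 : 0 ≤ ‖yosida l J x - yosida l J y‖ ^ 2 := by positivity
  rw [norm_sub_sq_real] at h2
  rw [← neg_sub x y, inner_neg_right, moreau, moreau]
  nlinarith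

theorem hasFDerivAt_moreau (hl : 0 < l) (hJ : IsResolvent D φ l J) (x : H) :
    HasFDerivAt (moreau φ l J) (innerSL ℝ (yosida l J x)) x := by
  rw [hasFDerivAt_iff_isLittleO]
  have hb : (fun y => moreau φ l J y - moreau φ l J x - innerSL ℝ (yosida l J x) (y - x))
      =O[nhds x] fun y => ‖y - x‖ ^ 2 := by
    refine Asymptotics.IsBigO.of_bound l⁻¹ (Filter.Eventually.of_forall fun y => ?_)
    have h1 := hJ.inner_le_moreau_sub hl x y
    have h2 := hJ.inner_le_moreau_sub hl y x
    have h3 := real_inner_le_norm (yosida l J y - yosida l J x) (y - x)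
    have h4 := mul_le_mul_of_nonneg_right (hJ.norm_yosida_sub_le hl y x) (norm_nonneg (y - x))
    rw [← neg_sub y x, inner_neg_right] at h2
    rw [inner_sub_left] at h3
    rw [innerSL_apply_apply, Real.norm_of_nonneg (by linarith), Real.norm_of_nonneg (by positivity)]
    nlinarith
  refine hb.trans_isLittleO ?_
  have h1 : (fun y : H => ‖y - x‖ ^ 2) =o[nhds x] fun y => ‖y - x‖ := by
    have ht : Filter.Tendsto (fun y : H => ‖y - x‖) (nhds x) (nhds 0) := by
      have : Continuous fun y : H => ‖y - x‖ := by fun_prop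
      simpa using this.tendsto x
    exact (Asymptotics.isLittleO_pow_id (𝕜 := ℝ) one_lt_two).comp_tendsto ht
  exact Asymptotics.isLittleO_norm_right.1 h1

theorem contDiff_moreau (hl : 0 < l) (hJ : IsResolvent D φ l J) :
    ContDiff ℝ 1 (moreau φ l J) := by
  rw [contDiff_one_iff_fderiv]
  refine ⟨fun x => (hJ.hasFDerivAt_moreau hl x).differentiableAt, ?_⟩
  rw [show fderiv ℝ (moreau φ l J) = fun x => innerSL ℝ (yosida l J x) from
    funext fun x => (hJ.hasFDerivAt_moreau hl x).fderiv]
  exact (innerSL ℝ).continuous.comp (hJ.continuous_yosida hl)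

theorem moreau_le (hl : 0 < l) (hJ : IsResolvent D φ l J) {x : H} (hx : x ∈ D) :
    moreau φ l J x ≤ φ x := by
  have h1 : φ (J x) ≤ φ x + inner ℝ (yosida l J x) (J x - x) := (hJ x).2 x hx
  have e : J x - x = -(l • yosida l J x) := by
    rw [resolvent_add_yosida hl J x]
    abel
  rw [e, inner_neg_right, inner_smul_right, real_inner_self_eq_norm_sq] at h1
  rw [moreau]
  nlinarith [sq_nonneg ‖yosida l J x‖]

end IsResolvent

/-- The metric projection onto a ball, as the resolvent of the subdifferential of its indicator. -/
theorem exists_ball_projection [CompleteSpace H] {R : ℝ} (hR : 0 ≤ R) :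
    ∃ P : H → H, LipschitzWith 1 P ∧ (∀ x, P x ∈ Metric.closedBall (0 : H) R) ∧
      ∀ x ∈ Metric.closedBall (0 : H) R, P x = x := by
  have hpot : ConvexPotential (Metric.closedBall (0 : H) R) (fun _ => 0) :=
    { convexOn := convexOn_const 0 (convex_closedBall 0 R)
      nonneg := fun _ _ => le_rfl
      nonempty := ⟨0, Metric.mem_closedBall_self hR⟩
      isClosed := (Metric.isClosed_closedBall.preimage continuous_fst).inter
        (isClosed_le continuous_const continuous_snd) }
  choose P hP using fun x => hpot.exists_resolvent one_pos x
  simp only [inv_one, one_smul] at hP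
  refine ⟨P, LipschitzWith.of_dist_le_mul fun x y => ?_, fun x => (hP x).1, fun x hx => ?_⟩
  · have h1 := inner_sub_nonneg_of_mem_realSubdiff (hP x) (hP y)
    have e : x - P x - (y - P y) = (x - y) - (P x - P y) := by abel
    rw [e, inner_sub_left, real_inner_self_eq_norm_sq] at h1
    have h2 := real_inner_le_norm (x - y) (P x - P y)
    rw [dist_eq_norm, dist_eq_norm, NNReal.coe_one, one_mul]
    by_contra hcon
    nlinarith [norm_nonneg (x - y), norm_nonneg (P x - P y)]
  · have h1 := (hP x).2 x hx
    rw [← neg_sub x, inner_neg_right, real_inner_self_eq_norm_sq] at h1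
    have h2 : ‖x - P x‖ ^ 2 = 0 := le_antisymm (by linarith) (by positivity)
    rw [sq_eq_zero_iff, norm_eq_zero, sub_eq_zero] at h2
    exact h2.symm

end ConvexPotential

/-! ### The regularised first order problem -/

theorem integrable_normSq {E : Type*} [NormedAddCommGroup E] {S : ℝ} {g : ℝ → E}
    (hg : MemLp g 2 (intervalMeasure S)) :
    Integrable (fun t => ‖g t‖ ^ 2) (intervalMeasure S) :=
  (memLp_two_iff_integrable_sq_norm hg.1).1 hg

theorem integrable_of_memLp {E : Type*} [NormedAddCommGroup E] {S : ℝ} {g : ℝ → E}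
    (hg : MemLp g 2 (intervalMeasure S)) : Integrable g (intervalMeasure S) :=
  hg.integrable one_le_two

/-- The Cauchy-Schwarz inequality against the constant function `1`. -/
theorem norm_intervalIntegral_sq_le {E : Type*} [NormedAddCommGroup E] [NormedSpace ℝ E] {S : ℝ}
    {g : ℝ → E} (hg : MemLp g 2 (intervalMeasure S)) {t : ℝ} (ht : t ∈ Icc 0 S) :
    ‖∫ s in 0..t, g s‖ ^ 2 ≤ t * ∫ s in 0..t, ‖g s‖ ^ 2 := by
  have h0 : (0 : ℝ) ∈ Icc 0 S := ⟨le_rfl, ht.1.trans ht.2⟩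
  have h1 : ‖∫ s in 0..t, g s‖ ≤ ∫ s in 0..t, ‖g s‖ :=
    intervalIntegral.norm_integral_le_integral_norm ht.1
  set I := ∫ s in 0..t, ‖g s‖ with hI
  have hgi := (integrable_of_memLp hg).norm
  rcases ht.1.eq_or_lt with h | h
  · simp [← h]
  -- Young's inequality with the mean value `I / t`
  have h2 : ∫ s in 0..t, 2 * (I / t) * ‖g s‖ ≤ ∫ s in 0..t, (‖g s‖ ^ 2 + (I / t) ^ 2) := by
    refine intervalIntegral_mono_of_ae le_rfl ht.1 ht.2 (hgi.const_mul _)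
      ((integrable_normSq hg).add (integrable_const _)) (ae_of_all _ fun s => ?_)
    show _ ≤ ‖g s‖ ^ 2 + (I / t) ^ 2
    nlinarith [sq_nonneg (‖g s‖ - I / t)]
  rw [intervalIntegral.integral_const_mul, intervalIntegral.integral_add
    (intervalIntegrable_of_integrable (integrable_normSq hg) h0 ht) (by simp),
    intervalIntegral.integral_const, ← hI, sub_zero, smul_eq_mul] at h2
  have h3 : I ^ 2 ≤ t * ∫ s in 0..t, ‖g s‖ ^ 2 := by
    have e1 : 2 * (I / t) * I = 2 * (I ^ 2 / t) := by ring
    have e2 : t * (I / t) ^ 2 = I ^ 2 / t := by field_simp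
    rw [e1, e2] at h2
    have h4 : I ^ 2 / t ≤ ∫ s in 0..t, ‖g s‖ ^ 2 := by linarith
    rw [div_le_iff₀ h] at h4
    linarith
  exact (pow_le_pow_left₀ (norm_nonneg _) h1 2).trans h3

section FirstOrder

variable {H : Type*} [NormedAddCommGroup H] [InnerProductSpace ℝ H] [CompleteSpace H]
  {D : Set H} {φ : H → ℝ} {T : ℝ} {h : ℝ → H} {v₀ : H}

/-- The regularised problem `v' + A v = h`, with `A` the Yosida approximation of `∂φ`, and the
energy estimate for `A v` that is uniform in the regularisation parameter. -/
theorem IsResolvent.exists_yosida_solution {l : ℝ} {J : H → H} (hl : 0 < l)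
    (hJ : IsResolvent D φ l J) (hpos : ∀ x ∈ D, 0 ≤ φ x) (hT : 0 ≤ T) (hv₀ : v₀ ∈ D)
    (hh : MemLp h 2 (intervalMeasure T)) :
    ∃ v : ℝ → H, v 0 = v₀ ∧ IsPrimitive T v (fun t => h t - yosida l J (v t)) ∧
      ∫ s in 0..T, ‖yosida l J (v s)‖ ^ 2 ≤ 2 * φ v₀ + ∫ s in 0..T, ‖h s‖ ^ 2 := by
  have hTT : T ∈ Icc 0 T := ⟨hT, le_rfl⟩
  have h0T : (0 : ℝ) ∈ Icc 0 T := ⟨le_rfl, hT⟩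
  have hAc : ∀ u : ℝ → H, ContinuousOn u (Icc 0 T) →
      ContinuousOn (fun t => yosida l J (u t)) (Icc 0 T) :=
    fun u hu => (hJ.continuous_yosida hl).comp_continuousOn hu
  have hm : ∀ u : ℝ → H, ContinuousOn u (Icc 0 T) →
      MemLp (fun t => h t - yosida l J (u t)) 2 (intervalMeasure T) :=
    fun u hu => hh.sub (memLp_of_continuousOn (hAc u hu) 2)
  obtain ⟨v, hvc, hv⟩ := exists_fixedPoint_of_volterra (S := T) (E := H)
    (k := fun _ => T * (l⁻¹) ^ 2) (integrable_const _) (ae_of_all _ fun _ => by positivity) hT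
    (fun u t => v₀ + ∫ s in 0..t, (h s - yosida l J (u s)))
    (fun u hu => (IsPrimitive.of_integrable
      (integrable_of_memLp (hm u hu)) v₀).continuousOn)
    (fun u w hu hw t ht => by
      have hmd : MemLp (fun s => yosida l J (w s) - yosida l J (u s)) 2 (intervalMeasure T) :=
        memLp_of_continuousOn ((hAc w hw).sub (hAc u hu)) 2
      rw [add_sub_add_left_eq_sub, ← intervalIntegral.integral_sub
        (intervalIntegrable_of_integrable (integrable_of_memLp (hm u hu)) h0T ht)
        (intervalIntegrable_of_integrable (integrable_of_memLp (hm w hw)) h0T ht)]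
      simp only [sub_sub_sub_cancel_left]
      have hcs := norm_intervalIntegral_sq_le hmd ht
      have hi := integrable_normSq hmd
      have hd : Integrable (fun s => ‖u s - w s‖ ^ 2) (intervalMeasure T) :=
        integrable_normSq (memLp_of_continuousOn (hu.sub hw) 2)
      refine hcs.trans ((mul_le_mul_of_nonneg_right ht.2
        (intervalIntegral_nonneg_of_ae ht hi (ae_of_all _ fun _ => by positivity))).trans ?_)
      rw [← intervalIntegral.integral_const_mul]
      refine intervalIntegral_mono_of_ae le_rfl ht.1 ht.2 (hi.const_mul _) (hd.const_mul _)
        (ae_of_all _ fun s => ?_)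
      have h1 := pow_le_pow_left₀ (norm_nonneg _) (hJ.norm_yosida_sub_le hl (w s) (u s)) 2
      rw [mul_pow, norm_sub_rev (w s)] at h1
      rw [mul_assoc]
      exact mul_le_mul_of_nonneg_left h1 hT)
  have hv0 : v 0 = v₀ := by
    rw [← hv 0 h0T]
    simp
  have hprim : IsPrimitive T v (fun t => h t - yosida l J (v t)) :=
    ⟨integrable_of_memLp (hm v hvc), fun t ht => by rw [hv0, ← hv t ht]⟩
  refine ⟨v, hv0, hprim, ?_⟩
  -- the energy balance: the derivative of the envelope along `v` is `(A v, h - A v)`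
  have hen := (hprim.comp_contDiff (hJ.contDiff_moreau hl))
  simp only [(hJ.hasFDerivAt_moreau hl _).fderiv, innerSL_apply_apply] at hen
  have henT : moreau φ l J (v T) = moreau φ l J (v 0) + _ := hen.2 T hTT
  rw [hv0] at henT
  have hAi := integrable_normSq (memLp_of_continuousOn (hAc v hvc) 2)
  have hhi := integrable_normSq hh
  have hle : ∫ s in 0..T, inner ℝ (yosida l J (v s)) (h s - yosida l J (v s)) ≤
      ∫ s in 0..T, (1 / 2 * ‖h s‖ ^ 2 - 1 / 2 * ‖yosida l J (v s)‖ ^ 2) := by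
    refine intervalIntegral_mono_of_ae le_rfl hT le_rfl hen.1
      ((hhi.const_mul _).sub (hAi.const_mul _)) (ae_of_all _ fun s => ?_)
    have := norm_sub_sq_real (h s) (yosida l J (v s))
    have h2 : 0 ≤ ‖h s - yosida l J (v s)‖ ^ 2 := by positivity
    show _ ≤ 1 / 2 * ‖h s‖ ^ 2 - 1 / 2 * ‖yosida l J (v s)‖ ^ 2
    rw [inner_sub_right, real_inner_self_eq_norm_sq, real_inner_comm]
    nlinarith
  rw [intervalIntegral.integral_sub
    ((intervalIntegrable_of_integrable hhi h0T hTT).const_mul _)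
    ((intervalIntegrable_of_integrable hAi h0T hTT).const_mul _),
    intervalIntegral.integral_const_mul, intervalIntegral.integral_const_mul] at hle
  have h1 := hJ.moreau_le hl hv₀
  have h2 : 0 ≤ moreau φ l J (v T) :=
    add_nonneg (hpos _ (hJ _).1) (by positivity)
  linarith

/-- Solutions of the regularised problems with parameters `l` and `l'` differ by `O(√(l + l'))`. -/
theorem IsResolvent.norm_sub_sq_le {l l' : ℝ} {J J' : H → H} (hl : 0 < l) (hl' : 0 < l')
    (hJ : IsResolvent D φ l J) (hJ' : IsResolvent D φ l' J') {v v' : ℝ → H}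
    (hv : IsPrimitive T v (fun t => h t - yosida l J (v t)))
    (hv' : IsPrimitive T v' (fun t => h t - yosida l' J' (v' t))) (h0 : v 0 = v' 0) {R : ℝ}
    (hR : ∫ s in 0..T, ‖yosida l J (v s)‖ ^ 2 ≤ R)
    (hR' : ∫ s in 0..T, ‖yosida l' J' (v' s)‖ ^ 2 ≤ R) {t : ℝ} (ht : t ∈ Icc 0 T) :
    ‖v t - v' t‖ ^ 2 ≤ 2 * R * (l + l') := by
  have h0T : (0 : ℝ) ∈ Icc 0 T := ⟨le_rfl, ht.1.trans ht.2⟩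
  have hTT : T ∈ Icc 0 T := ⟨ht.1.trans ht.2, le_rfl⟩
  have hA : Integrable (fun t => ‖yosida l J (v t)‖ ^ 2) (intervalMeasure T) :=
    integrable_normSq (memLp_of_continuousOn
      ((hJ.continuous_yosida hl).comp_continuousOn hv.continuousOn) 2)
  have hA' : Integrable (fun t => ‖yosida l' J' (v' t)‖ ^ 2) (intervalMeasure T) :=
    integrable_normSq (memLp_of_continuousOn
      ((hJ'.continuous_yosida hl').comp_continuousOn hv'.continuousOn) 2)
  have hsum := (hA.add hA').const_mul (l + l')
  have hen := (hv.sub hv').normSq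
  have het : ‖v t - v' t‖ ^ 2 = ‖v 0 - v' 0‖ ^ 2 + _ := hen.2 t ht
  rw [h0, sub_self, norm_zero] at het
  have hle : ∫ s in 0..t, 2 * inner ℝ (v s - v' s)
      (h s - yosida l J (v s) - (h s - yosida l' J' (v' s))) ≤
      ∫ s in 0..t, (l + l') * (‖yosida l J (v s)‖ ^ 2 + ‖yosida l' J' (v' s)‖ ^ 2) := by
    refine intervalIntegral_mono_of_ae le_rfl ht.1 ht.2 hen.1 hsum (ae_of_all _ fun s => ?_)
    -- by monotonicity `(v - v', a - b) ≥ (l a - l' b, a - b)`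
    set a := yosida l J (v s) with ha
    set b := yosida l' J' (v' s) with hb
    have hmon : 0 ≤ inner ℝ (a - b) (J (v s) - J' (v' s)) :=
      inner_sub_nonneg_of_mem_realSubdiff (hJ (v s)) (hJ' (v' s))
    rw [resolvent_add_yosida hl J, resolvent_add_yosida hl' J', ← ha, ← hb] at hmon
    have e : v s - l • a - (v' s - l' • b) = (v s - v' s) - (l • a - l' • b) := by abel
    rw [e, inner_sub_right] at hmon
    have e2 : h s - a - (h s - b) = -(a - b) := by abel
    show _ ≤ (l + l') * (‖a‖ ^ 2 + ‖b‖ ^ 2)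
    rw [e2, inner_neg_right, real_inner_comm]
    have e3 : inner ℝ (a - b) (l • a - l' • b) =
        l * ‖a‖ ^ 2 + l' * ‖b‖ ^ 2 - (l + l') * inner ℝ a b := by
      rw [inner_sub_left, inner_sub_right, inner_sub_right, inner_smul_right, inner_smul_right,
        inner_smul_right, inner_smul_right, real_inner_self_eq_norm_sq,
        real_inner_self_eq_norm_sq, real_inner_comm a b]
      ring
    have h4 : 0 ≤ ‖a - b‖ ^ 2 := by positivity
    rw [norm_sub_sq_real] at h4
    have h5 : 0 ≤ l * ‖a‖ ^ 2 := by positivity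
    have h6 : 0 ≤ l' * ‖b‖ ^ 2 := by positivity
    nlinarith
  have hmono := intervalIntegral_mono_right ht.1 ht.2 le_rfl hsum
    (ae_of_all _ fun s => by simp only [Pi.add_apply]; positivity)
  simp only [Pi.add_apply] at hmono
  rw [intervalIntegral.integral_const_mul (a := 0) (b := T), intervalIntegral.integral_add
    (intervalIntegrable_of_integrable hA h0T hTT)
    (intervalIntegrable_of_integrable hA' h0T hTT)] at hmono
  have h7 : 0 ≤ l + l' := by positivity
  nlinarith

end FirstOrder

/-! ### Passage to the limit in the first order problem -/

section FirstOrder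

variable {H : Type*} [NormedAddCommGroup H] [InnerProductSpace ℝ H]
  {D : Set H} {φ : H → ℝ} {T : ℝ} {h v : ℝ → H} {v₀ : H}

/-- The functions `η ∈ L²(0, T; H)` that solve `v' + η = h`, `η ∈ ∂φ(v)` up to an error `ε`: the
subgradient inequality holds at a perturbation `y` of `v` with a pointwise error `e` of integral
at most `ε`.  In contrast to the exact graph of `∂φ`, this set is convex in `η`. -/
def approxSelections (D : Set H) (φ : H → ℝ) (T : ℝ) (h v : ℝ → H) (v₀ : H) (ε : ℝ) :
    Set (Lp H 2 (intervalMeasure T)) :=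
  {η | (∃ (e : ℝ → ℝ) (y : ℝ → H), Integrable e (intervalMeasure T) ∧
      ∫ t, e t ∂(intervalMeasure T) ≤ ε ∧ ∀ᵐ t ∂(intervalMeasure T), y t ∈ D ∧
        ‖y t - v t‖ ≤ e t ∧ ∀ z ∈ D, φ (y t) ≤ φ z + inner ℝ (η t) (v t - z) + e t) ∧
    ∀ t ∈ Icc 0 T, ‖v₀ + (∫ s in 0..t, (h s - η s)) - v t‖ ≤ ε}

theorem approxSelections_mono {ε ε' : ℝ} (hε : ε ≤ ε') :
    approxSelections D φ T h v v₀ ε ⊆ approxSelections D φ T h v v₀ ε' := by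
  rintro η ⟨⟨e, y, he, hee, hy⟩, hη⟩
  exact ⟨⟨e, y, he, hee.trans hε, hy⟩, fun t ht => (hη t ht).trans hε⟩

theorem convex_approxSelections (hφ : ConvexOn ℝ D φ) (hh : MemLp h 2 (intervalMeasure T))
    (ε : ℝ) : Convex ℝ (approxSelections D φ T h v v₀ ε) := by
  rintro η₁ ⟨⟨e₁, y₁, he₁, hee₁, hy₁⟩, hη₁⟩ η₂ ⟨⟨e₂, y₂, he₂, hee₂, hy₂⟩, hη₂⟩ a b ha hb hab
  have hcoe : ∀ᵐ t ∂(intervalMeasure T), (a • η₁ + b • η₂ : Lp H 2 (intervalMeasure T)) t =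
      a • η₁ t + b • η₂ t := by
    filter_upwards [Lp.coeFn_add (a • η₁) (b • η₂), Lp.coeFn_smul a η₁, Lp.coeFn_smul b η₂]
      with t h1 h2 h3
    rw [h1, Pi.add_apply, h2, h3, Pi.smul_apply, Pi.smul_apply]
  refine ⟨⟨fun t => a * e₁ t + b * e₂ t, fun t => a • y₁ t + b • y₂ t,
    (he₁.const_mul a).add (he₂.const_mul b), ?_, ?_⟩, fun t ht => ?_⟩
  · rw [integral_add (he₁.const_mul a) (he₂.const_mul b), integral_const_mul, integral_const_mul]
    calc a * _ + b * _ ≤ a * ε + b * ε := by gcongr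
      _ = ε := by rw [← add_mul, hab, one_mul]
  · filter_upwards [hcoe, hy₁, hy₂] with t hc h1 h2
    refine ⟨hφ.1 h1.1 h2.1 ha hb hab, ?_, fun z hz => ?_⟩
    · have e : a • y₁ t + b • y₂ t - v t = a • (y₁ t - v t) + b • (y₂ t - v t) := by
        have : v t = (a + b) • v t := by rw [hab, one_smul]
        nth_rw 1 [this]
        module
      rw [e]
      refine (norm_add_le _ _).trans ?_
      rw [norm_smul, norm_smul, Real.norm_of_nonneg ha, Real.norm_of_nonneg hb]
      exact add_le_add (mul_le_mul_of_nonneg_left h1.2.1 ha)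
        (mul_le_mul_of_nonneg_left h2.2.1 hb)
    · have h3 := hφ.2 h1.1 h2.1 ha hb hab
      have h4 := mul_le_mul_of_nonneg_left (h1.2.2 z hz) ha
      have h5 := mul_le_mul_of_nonneg_left (h2.2.2 z hz) hb
      rw [hc, inner_add_left, inner_smul_left, inner_smul_left]
      simp only [smul_eq_mul, RCLike.conj_to_real] at h3 ⊢
      have h6 : φ z = a * φ z + b * φ z := by rw [← add_mul, hab, one_mul]
      linarith
  · have h0T : (0 : ℝ) ∈ Icc 0 T := ⟨le_rfl, ht.1.trans ht.2⟩
    have hi : ∀ η : Lp H 2 (intervalMeasure T),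
        IntervalIntegrable (fun s => h s - η s) volume 0 t :=
      fun η => intervalIntegrable_of_integrable
        (integrable_of_memLp (hh.sub (Lp.memLp η))) h0T ht
    have i₁ : IntervalIntegrable (fun s => a • (h s - η₁ s)) volume 0 t := (hi η₁).smul a
    have i₂ : IntervalIntegrable (fun s => b • (h s - η₂ s)) volume 0 t := (hi η₂).smul b
    have e1 : ∫ s in 0..t, (h s - (a • η₁ + b • η₂ : Lp H 2 (intervalMeasure T)) s) =
        a • (∫ s in 0..t, (h s - η₁ s)) + b • ∫ s in 0..t, (h s - η₂ s) := by
      rw [← intervalIntegral.integral_smul, ← intervalIntegral.integral_smul,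
        ← intervalIntegral.integral_add i₁ i₂]
      refine intervalIntegral_congr_of_ae ht ?_
      filter_upwards [hcoe] with s hs
      have : h s = (a + b) • h s := by rw [hab, one_smul]
      rw [hs]
      nth_rw 1 [this]
      module
    have e2 : v₀ + (a • (∫ s in 0..t, (h s - η₁ s)) + b • ∫ s in 0..t, (h s - η₂ s)) - v t =
        a • (v₀ + (∫ s in 0..t, (h s - η₁ s)) - v t) +
          b • (v₀ + (∫ s in 0..t, (h s - η₂ s)) - v t) := by
      have : v₀ - v t = (a + b) • (v₀ - v t) := by rw [hab, one_smul]
      rw [add_sub_right_comm, this]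
      module
    rw [e1, e2]
    refine (norm_add_le _ _).trans ?_
    rw [norm_smul, norm_smul, Real.norm_of_nonneg ha, Real.norm_of_nonneg hb]
    calc a * _ + b * _ ≤ a * ε + b * ε := by
          gcongr
          · exact hη₁ t ht
          · exact hη₂ t ht
      _ = ε := by rw [← add_mul, hab, one_mul]

theorem integral_norm_sq_eq_norm_Lp_sq (η : Lp H 2 (intervalMeasure T)) :
    ∫ t, ‖η t‖ ^ 2 ∂(intervalMeasure T) = ‖η‖ ^ 2 := by
  rw [← real_inner_self_eq_norm_sq, L2.inner_def]
  simp only [real_inner_self_eq_norm_sq]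

/-- Strong limits of approximate selections whose errors tend to zero are exact. -/
theorem of_tendsto_approxSelections [CompleteSpace H] (hφ : ConvexPotential D φ)
    (hh : MemLp h 2 (intervalMeasure T)) {ε : ℕ → ℝ} (hε : Filter.Tendsto ε Filter.atTop (nhds 0))
    {η : ℕ → Lp H 2 (intervalMeasure T)} {ηl : Lp H 2 (intervalMeasure T)}
    (hη : ∀ n, η n ∈ approxSelections D φ T h v v₀ (ε n))
    (hlim : Filter.Tendsto η Filter.atTop (nhds ηl)) :
    (∀ᵐ t ∂(intervalMeasure T), ηl t ∈ realSubdiff D φ (v t)) ∧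
      ∀ t ∈ Icc 0 T, v t = v₀ + ∫ s in 0..t, (h s - ηl s) := by
  constructor
  · choose e y he hee hy using fun n => (hη n).1
    have he0 : ∀ n, ∀ᵐ t ∂(intervalMeasure T), 0 ≤ e n t := fun n =>
      (hy n).mono fun t ht => (norm_nonneg _).trans ht.2.1
    have hem : TendstoInMeasure (intervalMeasure T) e Filter.atTop (0 : ℝ → ℝ) := by
      refine tendstoInMeasure_of_tendsto_eLpNorm one_ne_zero (fun n => (he n).1)
        aestronglyMeasurable_zero ?_
      have e1 : ∀ n, eLpNorm (e n - 0) 1 (intervalMeasure T) =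
          ENNReal.ofReal (∫ t, e n t ∂(intervalMeasure T)) := fun n => by
        rw [sub_zero, eLpNorm_one_eq_lintegral_enorm,
          ← ofReal_integral_norm_eq_lintegral_enorm (he n)]
        congr 1
        exact integral_congr_ae ((he0 n).mono fun t ht => Real.norm_of_nonneg ht)
      simp only [e1]
      have h1 : Filter.Tendsto (fun n => ∫ t, e n t ∂(intervalMeasure T)) Filter.atTop (nhds 0) :=
        squeeze_zero (fun n => integral_nonneg_of_ae (he0 n)) hee hε
      simpa using ENNReal.tendsto_ofReal h1
    -- along a common subsequence both `η n` and the errors converge almost everywhere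
    obtain ⟨n₁, hn₁, hlim₁⟩ := (tendstoInMeasure_of_tendsto_Lp hlim).exists_seq_tendsto_ae
    obtain ⟨n₂, hn₂, hlim₂⟩ := (hem.comp hn₁.tendsto_atTop).exists_seq_tendsto_ae
    filter_upwards [hlim₁, hlim₂, ae_all_iff.2 hy] with t h1 h2 h3
    have hη' := h1.comp hn₂.tendsto_atTop
    set k : ℕ → ℕ := fun i => n₁ (n₂ i) with hk
    have he' : Filter.Tendsto (fun i => e (k i) t) Filter.atTop (nhds 0) := h2
    have hy' : Filter.Tendsto (fun i => y (k i) t) Filter.atTop (nhds (v t)) := by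
      rw [tendsto_iff_norm_sub_tendsto_zero]
      exact squeeze_zero (fun i => norm_nonneg _) (fun i => (h3 (k i)).2.1) he'
    have key : ∀ z ∈ D, v t ∈ D ∧ φ (v t) ≤ φ z + inner ℝ (ηl t) (v t - z) := by
      intro z hz
      have hl : Filter.Tendsto
          (fun i => (y (k i) t, φ z + inner ℝ (η (k i) t) (v t - z) + e (k i) t)) Filter.atTop
          (nhds (v t, φ z + inner ℝ (ηl t) (v t - z) + 0)) :=
        hy'.prodMk_nhds ((tendsto_const_nhds.add (hη'.inner tendsto_const_nhds)).add he')
      rw [add_zero] at hl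
      exact hφ.isClosed.mem_of_tendsto hl
        (Filter.Eventually.of_forall fun i => ⟨(h3 (k i)).1, (h3 (k i)).2.2 z hz⟩)
    obtain ⟨z, hz⟩ := hφ.nonempty
    exact ⟨(key z hz).1, fun z hz => (key z hz).2⟩
  · intro t ht
    have h0T : (0 : ℝ) ∈ Icc 0 T := ⟨le_rfl, ht.1.trans ht.2⟩
    have hi : ∀ η : Lp H 2 (intervalMeasure T),
        IntervalIntegrable (fun s => h s - η s) volume 0 t :=
      fun η => intervalIntegrable_of_integrable
        (integrable_of_memLp (hh.sub (Lp.memLp η))) h0T ht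
    have hb : ∀ n, ‖(∫ s in 0..t, (h s - η n s)) - ∫ s in 0..t, (h s - ηl s)‖ ^ 2 ≤
        t * ‖ηl - η n‖ ^ 2 := by
      intro n
      rw [← intervalIntegral.integral_sub (hi _) (hi _)]
      have e1 : ∫ s in 0..t, (h s - η n s - (h s - ηl s)) =
          ∫ s in 0..t, (ηl - η n : Lp H 2 (intervalMeasure T)) s := by
        refine intervalIntegral_congr_of_ae ht ?_
        filter_upwards [Lp.coeFn_sub ηl (η n)] with s hs
        rw [hs, sub_sub_sub_cancel_left, Pi.sub_apply]
      rw [e1]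
      refine (norm_intervalIntegral_sq_le (Lp.memLp _) ht).trans
        (mul_le_mul_of_nonneg_left ?_ ht.1)
      rw [← integral_norm_sq_eq_norm_Lp_sq, ← intervalIntegral_eq_setIntegral_Ioo h0T.2]
      exact intervalIntegral_mono_right ht.1 ht.2 le_rfl (integrable_normSq (Lp.memLp _))
        (ae_of_all _ fun s => by positivity)
    have hz : Filter.Tendsto (fun n => t * ‖ηl - η n‖ ^ 2) Filter.atTop (nhds 0) := by
      simpa using (((tendsto_const_nhds (x := ηl)).sub hlim).norm.pow 2).const_mul t
    have hI : Filter.Tendsto (fun n => ∫ s in 0..t, (h s - η n s)) Filter.atTop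
        (nhds (∫ s in 0..t, (h s - ηl s))) := by
      rw [tendsto_iff_norm_sub_tendsto_zero]
      simpa [Real.sqrt_sq (norm_nonneg _)] using
        (squeeze_zero (fun n => by positivity) hb hz).sqrt
    have hle := le_of_tendsto_of_tendsto' ((((tendsto_const_nhds (x := v₀)).add hI).sub
      (tendsto_const_nhds (x := v t))).norm) hε fun n => (hη n).2 t ht
    exact (sub_eq_zero.1 (norm_le_zero_iff.1 hle)).symm

/-- Solvability of the first order problem `v' + ∂φ(v) ∋ h`, `v(0) = v₀ ∈ D(φ)`. -/
theorem ConvexPotential.exists_solution [CompleteSpace H] (hφ : ConvexPotential D φ) (hT : 0 ≤ T)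
    (hv₀ : v₀ ∈ D) (hh : MemLp h 2 (intervalMeasure T)) :
    ∃ v η : ℝ → H, v 0 = v₀ ∧ MemLp η 2 (intervalMeasure T) ∧
      IsPrimitive T v (fun t => h t - η t) ∧
      ∀ᵐ t ∂(intervalMeasure T), η t ∈ realSubdiff D φ (v t) := by
  set l : ℕ → ℝ := fun n => 1 / ((n : ℝ) + 1) with hl_def
  have hl : ∀ n, 0 < l n := fun n => by positivity
  have hlanti : Antitone l := fun n m hnm => by
    simp only [hl_def]
    gcongr
  have hl0 : Filter.Tendsto l Filter.atTop (nhds 0) := tendsto_one_div_add_atTop_nhds_zero_nat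
  choose J hJ using fun n => fun x => hφ.exists_resolvent (hl n) x
  have hJ : ∀ n, IsResolvent D φ (l n) (J n) := hJ
  set R := 2 * φ v₀ + ∫ s in 0..T, ‖h s‖ ^ 2 with hR
  choose V hV0 hV hVR using fun n =>
    (hJ n).exists_yosida_solution (hl n) hφ.nonneg hT hv₀ hh
  have hTT : T ∈ Icc 0 T := ⟨hT, le_rfl⟩
  have h0T : (0 : ℝ) ∈ Icc 0 T := ⟨le_rfl, hT⟩
  have hR0 : 0 ≤ R := (intervalIntegral_nonneg_of_ae hTT (integrable_normSq
    (memLp_of_continuousOn (((hJ 0).continuous_yosida (hl 0)).comp_continuousOn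
      (hV 0).continuousOn) 2)) (ae_of_all _ fun s => by positivity)).trans (hVR 0)
  have hcau : ∀ n m, ∀ t ∈ Icc 0 T, ‖V n t - V m t‖ ^ 2 ≤ 2 * R * (l n + l m) :=
    fun n m t ht => (hJ n).norm_sub_sq_le (hl n) (hl m) (hJ m) (hV n) (hV m)
      (by rw [hV0, hV0]) (hVR n) (hVR m) ht
  have hlim : ∀ t, ∃ x, t ∈ Icc 0 T → Filter.Tendsto (fun n => V n t) Filter.atTop (nhds x) := by
    intro t
    by_cases ht : t ∈ Icc 0 T
    · have hC : CauchySeq fun n => V n t := by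
        refine cauchySeq_of_le_tendsto_0 (fun N => Real.sqrt (4 * R * l N)) ?_ ?_
        · intro n m N hn hm
          rw [dist_eq_norm]
          refine Real.le_sqrt_of_sq_le ((hcau n m t ht).trans ?_)
          nlinarith [hlanti hn, hlanti hm]
        · simpa using (hl0.const_mul (4 * R)).sqrt
      obtain ⟨x, hx⟩ := cauchySeq_tendsto_of_complete hC
      exact ⟨x, fun _ => hx⟩
    · exact ⟨0, fun h => (ht h).elim⟩
  choose v hv using hlim
  set δ : ℕ → ℝ := fun n => Real.sqrt (2 * R * l n) with hδ
  have hδ0 : Filter.Tendsto δ Filter.atTop (nhds 0) := by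
    simpa using (hl0.const_mul (2 * R)).sqrt
  have hδanti : Antitone δ := fun n m hnm =>
    Real.sqrt_le_sqrt (mul_le_mul_of_nonneg_left (hlanti hnm) (by positivity))
  have hVv : ∀ n, ∀ t ∈ Icc 0 T, ‖V n t - v t‖ ≤ δ n := by
    intro n t ht
    refine Real.le_sqrt_of_sq_le ?_
    have h1 := ((tendsto_const_nhds (x := V n t)).sub (hv t ht)).norm.pow 2
    have h2 : Filter.Tendsto (fun m => 2 * R * (l n + l m)) Filter.atTop
        (nhds (2 * R * (l n + 0))) := (tendsto_const_nhds.add hl0).const_mul _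
    rw [add_zero] at h2
    exact le_of_tendsto_of_tendsto' h1 h2 fun m => hcau n m t ht
  have hAc : ∀ n, ContinuousOn (fun t => yosida (l n) (J n) (V n t)) (Icc 0 T) := fun n =>
    ((hJ n).continuous_yosida (hl n)).comp_continuousOn (hV n).continuousOn
  have hAm : ∀ n, MemLp (fun t => yosida (l n) (J n) (V n t)) 2 (intervalMeasure T) := fun n =>
    memLp_of_continuousOn (hAc n) 2
  -- the Yosida terms `W n` are approximate selections with error `ε n`, with the perturbation
  -- `y = J (V n)`, for which `|y - v| ≤ l |W n| + δ`
  set W : ℕ → Lp H 2 (intervalMeasure T) := fun n => (hAm n).toLp _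
  have hW : ∀ n, ∀ᵐ t ∂(intervalMeasure T), W n t = yosida (l n) (J n) (V n t) := fun n =>
    (hAm n).coeFn_toLp
  set ε : ℕ → ℝ := fun n => (l n + δ n) * (R + T + 1) with hε
  have hε0 : Filter.Tendsto ε Filter.atTop (nhds 0) := by
    simpa using (hl0.add hδ0).mul_const (R + T + 1)
  have hεanti : Antitone ε := fun n m hnm =>
    mul_le_mul_of_nonneg_right (add_le_add (hlanti hnm) (hδanti hnm)) (by positivity)
  have hmem : ∀ n, W n ∈ approxSelections D φ T h v v₀ (ε n) := by
    intro n
    have hδn : 0 ≤ δ n := Real.sqrt_nonneg _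
    have hln := (hl n).le
    have hAi := integrable_normSq (hAm n)
    refine ⟨⟨fun t => (l n + δ n) * (‖yosida (l n) (J n) (V n t)‖ ^ 2 + 1),
      fun t => J n (V n t), (hAi.add (integrable_const 1)).const_mul _, ?_, ?_⟩, fun t ht => ?_⟩
    · rw [integral_const_mul, integral_add hAi (integrable_const 1),
        ← intervalIntegral_eq_setIntegral_Ioo hT, ← intervalIntegral_eq_setIntegral_Ioo hT]
      simp only [intervalIntegral.integral_const, sub_zero, smul_eq_mul, mul_one]
      refine mul_le_mul_of_nonneg_left ?_ (by positivity)
      linarith [hVR n]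
    · filter_upwards [hW n, ae_restrict_mem measurableSet_Ioo] with t hc ht
      set A := yosida (l n) (J n) (V n t) with hA
      have h1 : ‖J n (V n t) - v t‖ ≤ l n * ‖A‖ + δ n := by
        rw [resolvent_add_yosida (hl n) (J n), ← hA, sub_right_comm]
        refine (norm_sub_le _ _).trans ?_
        rw [norm_smul, Real.norm_of_nonneg hln, add_comm]
        gcongr
        exact hVv n t (Ioo_subset_Icc_self ht)
      have h2 : 0 ≤ (‖A‖ - 1 / 2) ^ 2 := by positivity
      refine ⟨(hJ n _).1, h1.trans (by nlinarith), fun z hz => ?_⟩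
      have h3 : φ (J n (V n t)) ≤ φ z + inner ℝ A (J n (V n t) - z) := (hJ n (V n t)).2 z hz
      rw [hc]
      show _ ≤ φ z + inner ℝ A (v t - z) + _
      have e : J n (V n t) - z = (v t - z) + (J n (V n t) - v t) := by abel
      rw [e, inner_add_right] at h3
      have h4 := (real_inner_le_norm A (J n (V n t) - v t)).trans
        (mul_le_mul_of_nonneg_left h1 (norm_nonneg A))
      nlinarith
    · have e1 : ∫ s in 0..t, (h s - W n s) =
          ∫ s in 0..t, (h s - yosida (l n) (J n) (V n s)) := by
        refine intervalIntegral_congr_of_ae ht ?_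
        filter_upwards [hW n] with s hs
        rw [hs]
      rw [e1, ← hV0 n, ← (hV n).2 t ht]
      refine (hVv n t ht).trans ?_
      simp only [hε]
      nlinarith
  have hnorm : ∀ n, ‖W n‖ ^ 2 ≤ R := by
    intro n
    rw [← integral_norm_sq_eq_norm_Lp_sq]
    refine le_trans (le_of_eq ?_) (hVR n)
    rw [intervalIntegral_eq_setIntegral_Ioo hT]
    refine integral_congr_ae ?_
    filter_upwards [hW n] with s hs
    rw [hs]
  obtain ⟨η, ηl, hη, hηl⟩ := exists_tendsto_of_antitone_convex
    (C := fun n => approxSelections D φ T h v v₀ (ε n))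
    (fun n m hnm => approxSelections_mono (hεanti hnm))
    (fun n => convex_approxSelections hφ.convexOn hh _)
    (fun n => ⟨_, hmem n, hnorm n⟩)
  obtain ⟨h1, h2⟩ := of_tendsto_approxSelections hφ hh hε0 hη hηl
  have hv0 : v 0 = v₀ := by simpa using h2 0 h0T
  refine ⟨v, ηl, hv0, Lp.memLp ηl, ⟨integrable_of_memLp (hh.sub (Lp.memLp ηl)),
    fun t ht => ?_⟩, h1⟩
  rw [hv0]
  exact h2 t ht

/-- Solutions of the first order problem depend continuously on the right hand side. -/
theorem norm_sub_sq_le_of_first_order [CompleteSpace H]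
    {h₁ h₂ v₁ v₂ η₁ η₂ : ℝ → H}
    (hv₁ : IsPrimitive T v₁ (fun t => h₁ t - η₁ t)) (hv₂ : IsPrimitive T v₂ (fun t => h₂ t - η₂ t))
    (h0 : v₁ 0 = v₂ 0) (hη₁ : ∀ᵐ t ∂(intervalMeasure T), η₁ t ∈ realSubdiff D φ (v₁ t))
    (hη₂ : ∀ᵐ t ∂(intervalMeasure T), η₂ t ∈ realSubdiff D φ (v₂ t))
    (hh : MemLp (fun t => h₁ t - h₂ t) 2 (intervalMeasure T)) {t : ℝ} (ht : t ∈ Icc 0 T) :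
    ‖v₁ t - v₂ t‖ ^ 2 ≤ Real.exp T * ∫ s in 0..t, ‖h₁ s - h₂ s‖ ^ 2 := by
  have hw := ((hv₁.sub hv₂).mono ht.2).normSq
  have hhi := integrable_normSq (memLp_intervalMeasure_mono ht.2 hh)
  have htt : t ∈ Icc 0 t := ⟨ht.1, le_rfl⟩
  have key := le_mul_exp_of_le_add_integral_mul (S := t) (k := fun _ => 1)
    (y := fun t => ‖v₁ t - v₂ t‖ ^ 2) (c := ∫ s in 0..t, ‖h₁ s - h₂ s‖ ^ 2) (integrable_const 1)
    (ae_of_all _ fun _ => zero_le_one) hw.continuousOn (fun r hr => by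
      have h0r : (0 : ℝ) ∈ Icc 0 t := ⟨le_rfl, ht.1⟩
      have e1 : ‖v₁ r - v₂ r‖ ^ 2 = ‖v₁ 0 - v₂ 0‖ ^ 2 + _ := hw.2 r hr
      have hci := integrable_mul_continuousOn (integrable_const (1 : ℝ)) hw.continuousOn
      have e2 : ∫ s in 0..r, 2 * inner ℝ (v₁ s - v₂ s) (h₁ s - η₁ s - (h₂ s - η₂ s)) ≤
          (∫ s in 0..r, ‖h₁ s - h₂ s‖ ^ 2) + ∫ s in 0..r, 1 * ‖v₁ s - v₂ s‖ ^ 2 := by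
        rw [← intervalIntegral.integral_add (intervalIntegrable_of_integrable hhi h0r hr)
          (intervalIntegrable_of_integrable hci h0r hr)]
        refine intervalIntegral_mono_of_ae le_rfl hr.1 hr.2 hw.1 (hhi.add hci) ?_
        filter_upwards [ae_intervalMeasure_mono ht.2 hη₁, ae_intervalMeasure_mono ht.2 hη₂]
          with s m1 m2
        have hmon := inner_sub_nonneg_of_mem_realSubdiff m1 m2
        have e : h₁ s - η₁ s - (h₂ s - η₂ s) = (h₁ s - h₂ s) - (η₁ s - η₂ s) := by abel
        show _ ≤ ‖h₁ s - h₂ s‖ ^ 2 + 1 * ‖v₁ s - v₂ s‖ ^ 2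
        rw [e, inner_sub_right, real_inner_comm (η₁ s - η₂ s)]
        have i1 := real_inner_le_norm (v₁ s - v₂ s) (h₁ s - h₂ s)
        nlinarith [sq_nonneg (‖v₁ s - v₂ s‖ - ‖h₁ s - h₂ s‖)]
      have e3 := intervalIntegral_mono_right hr.1 hr.2 le_rfl hhi
        (ae_of_all _ fun s => by positivity)
      rw [h0, sub_self, norm_zero] at e1
      show ‖v₁ r - v₂ r‖ ^ 2 ≤ _
      linarith) t htt
  have hnn := intervalIntegral_nonneg_of_ae htt hhi (ae_of_all _ fun s => by positivity)
  refine key.trans ?_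
  rw [mul_comm]
  refine mul_le_mul_of_nonneg_right (Real.exp_le_exp.2 ?_) hnn
  simpa using ht.2

end FirstOrder

/-! ### Normalisation of the dissipation potential -/

section Normalisation

variable {H : Type*} [NormedAddCommGroup H] [InnerProductSpace ℝ H] {Ψ : H → EReal}

theorem IsDissipationPotential.coe_toReal (hΨ : IsDissipationPotential Ψ) {x : H}
    (hx : x ∈ effDomain Ψ) : ((Ψ x).toReal : EReal) = Ψ x :=
  EReal.coe_toReal hx (hΨ.ne_bot x)

theorem IsDissipationPotential.subdiff_eq (hΨ : IsDissipationPotential Ψ) (x : H) :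
    subdiff Ψ x = realSubdiff (effDomain Ψ) (fun z => (Ψ z).toReal) x := by
  ext ξ
  refine and_congr_right fun hx => ⟨fun h z hz => ?_, fun h z => ?_⟩
  · have h1 := h z
    rw [← hΨ.coe_toReal hx, ← hΨ.coe_toReal hz, ← EReal.coe_sub, EReal.coe_le_coe_iff] at h1
    linarith
  · by_cases hz : z ∈ effDomain Ψ
    · rw [← hΨ.coe_toReal hx, ← hΨ.coe_toReal hz, ← EReal.coe_sub, EReal.coe_le_coe_iff]
      linarith [h z hz]
    · have hz' : Ψ z = ⊤ := not_not.1 hz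
      rw [hz', EReal.sub_top]
      exact bot_le

theorem IsDissipationPotential.inner_sub_nonneg (hΨ : IsDissipationPotential Ψ) {x y ξ ζ : H}
    (hξ : ξ ∈ subdiff Ψ x) (hζ : ζ ∈ subdiff Ψ y) : 0 ≤ inner ℝ (ξ - ζ) (x - y) := by
  rw [hΨ.subdiff_eq] at hξ hζ
  exact inner_sub_nonneg_of_mem_realSubdiff hξ hζ

/-- `Ψ` minus its affine minorant `Ψ 0 + (ξ₀, ·)` given by `ξ₀ ∈ ∂Ψ(0)`.  The value is meaningful on
the effective domain only, since `EReal.toReal ⊤ = 0`. -/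
noncomputable def normalised (Ψ : H → EReal) (ξ₀ : H) (x : H) : ℝ :=
  (Ψ x).toReal - (Ψ 0).toReal - inner ℝ ξ₀ x

theorem IsDissipationPotential.add_mem_subdiff (hΨ : IsDissipationPotential Ψ) {ξ₀ ξ x : H}
    (hξ : ξ ∈ realSubdiff (effDomain Ψ) (normalised Ψ ξ₀) x) : ξ + ξ₀ ∈ subdiff Ψ x := by
  rw [hΨ.subdiff_eq]
  refine ⟨hξ.1, fun z hz => ?_⟩
  have h := hξ.2 z hz
  simp only [normalised] at h
  rw [inner_add_left, inner_sub_right ξ₀]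
  linarith

theorem IsDissipationPotential.convexPotential (hΨ : IsDissipationPotential Ψ) {ξ₀ : H}
    (hξ₀ : ξ₀ ∈ subdiff Ψ 0) : ConvexPotential (effDomain Ψ) (normalised Ψ ξ₀) := by
  have hle : ∀ x ∈ effDomain Ψ, ∀ y ∈ effDomain Ψ, ∀ a b : ℝ, 0 < a → 0 < b → a + b = 1 →
      Ψ (a • x + b • y) ≤ ((a * (Ψ x).toReal + b * (Ψ y).toReal : ℝ) : EReal) := by
    intro x hx y hy a b ha hb hab
    have h := hΨ.convex x y a b ha hb hab
    rwa [← hΨ.coe_toReal hx, ← hΨ.coe_toReal hy, ← EReal.coe_mul, ← EReal.coe_mul,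
      ← EReal.coe_add] at h
  have hconv : Convex ℝ (effDomain Ψ) := convex_iff_forall_pos.2 fun x hx y hy a b ha hb hab h => by
    have h1 := hle x hx y hy a b ha hb hab
    rw [h] at h1
    exact absurd h1 (not_le.2 (EReal.coe_lt_top _))
  refine ⟨convexOn_iff_forall_pos.2 ⟨hconv, fun x hx y hy a b ha hb hab => ?_⟩, fun x hx => ?_,
    hΨ.proper, ?_⟩
  · have h1 := hle x hx y hy a b ha hb hab
    rw [← hΨ.coe_toReal (hconv hx hy ha.le hb.le hab), EReal.coe_le_coe_iff] at h1
    simp only [normalised, smul_eq_mul]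
    rw [inner_add_right, inner_smul_right, inner_smul_right]
    have h2 : (Ψ 0).toReal = a * (Ψ 0).toReal + b * (Ψ 0).toReal := by
      rw [← add_mul, hab, one_mul]
    linarith
  · rw [hΨ.subdiff_eq] at hξ₀
    have h := hξ₀.2 x hx
    simp only [zero_sub, inner_neg_right] at h
    simp only [normalised]
    linarith
  · have hc : Continuous fun p : H × ℝ =>
        (p.1, ((p.2 + (Ψ 0).toReal + inner ℝ ξ₀ p.1 : ℝ) : EReal)) := by
      refine continuous_fst.prodMk (continuous_coe_real_ereal.comp ?_)
      fun_prop
    convert! hΨ.lsc.isClosed_epigraph.preimage hc using 1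
    ext ⟨x, r⟩
    simp only [mem_preimage, mem_ofPred_eq, normalised]
    constructor
    · rintro ⟨hx, h⟩
      rw [← hΨ.coe_toReal hx, EReal.coe_le_coe_iff]
      linarith
    · intro h
      have hx : x ∈ effDomain Ψ := fun h' => by
        rw [h'] at h
        exact absurd h (not_le.2 (EReal.coe_lt_top _))
      rw [← hΨ.coe_toReal hx, EReal.coe_le_coe_iff] at h
      exact ⟨hx, by linarith⟩

end Normalisation

/-! ### The second order problem -/

section Perturbation

variable {E : Type*} [NormedAddCommGroup E] {B : ℝ → E → E} {T : ℝ}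

theorem memLp_comp_of_lipschitz {u : ℝ → E} {α b : ℝ → ℝ} (hα : MemLp α 2 (intervalMeasure T))
    (hB : ∀ᵐ t ∂(intervalMeasure T), ∀ x y : E, ‖B t x - B t y‖ ≤ α t * ‖x - y‖)
    (hb : MemLp b 2 (intervalMeasure T)) (hB0 : ∀ᵐ t ∂(intervalMeasure T), ‖B t 0‖ ≤ b t)
    (hmeas : ∀ v : ℝ → E, AEStronglyMeasurable v (intervalMeasure T) →
      AEStronglyMeasurable (fun t => B t (v t)) (intervalMeasure T))
    (hu : ContinuousOn u (Icc 0 T)) : MemLp (fun t => B t (u t)) 2 (intervalMeasure T) := by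
  obtain ⟨C, hC⟩ := isCompact_Icc.exists_bound_of_continuousOn hu
  refine ((hα.norm.mul_const C).add hb).mono
    (hmeas u (memLp_of_continuousOn hu 2).1) ?_
  filter_upwards [hB, hB0, ae_restrict_mem measurableSet_Ioo] with t h1 h2 ht
  have h3 := h1 (u t) 0
  rw [sub_zero] at h3
  have h4 := norm_le_norm_add_norm_sub' (B t (u t)) (B t 0)
  have h5 : α t * ‖u t‖ ≤ ‖α t‖ * C :=
    mul_le_mul (le_abs_self _) (hC t (Ioo_subset_Icc_self ht)) (norm_nonneg _) (norm_nonneg _)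
  simp only [Pi.add_apply]
  refine le_trans ?_ (le_abs_self _)
  linarith

/-- The modulus of a global Lipschitz condition may be negative only if the space is trivial. -/
theorem IsGloballyLipschitz.ae_nonneg [Nontrivial E] {α : ℝ → ℝ}
    (h : IsGloballyLipschitz T B α) : ∀ᵐ t ∂(intervalMeasure T), 0 ≤ α t := by
  obtain ⟨x, hx⟩ := exists_ne (0 : E)
  filter_upwards [h.2] with t ht
  have h1 := (norm_nonneg _).trans (ht x 0)
  rw [sub_zero] at h1
  exact nonneg_of_mul_nonneg_left h1 (norm_pos_iff.2 hx)

end Perturbation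

section SecondOrder

variable {H : Type*} [NormedAddCommGroup H] [InnerProductSpace ℝ H]
  {Ψ : H → EReal} {B : ℝ → H → H} {S T : ℝ} {u₀ v₀ : H} {f : ℝ → H} {u : ℝ → H}

/-- Strong solutions in integrated form, with `v = u'`, `g = u''` and `η ∈ ∂Ψ(u')`. -/
structure IsIntegratedSolution (S : ℝ) (Ψ : H → EReal) (B : ℝ → H → H) (f : ℝ → H) (u₀ v₀ : H)
    (u v g η : ℝ → H) : Prop where
  primitive : IsPrimitive S u v
  primitive_deriv : IsPrimitive S v g
  equation : ∀ᵐ t ∂(intervalMeasure S), g t + η t + B t (u t) = f t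
  mem_subdiff : ∀ᵐ t ∂(intervalMeasure S), η t ∈ subdiff Ψ (v t)
  initial : u 0 = u₀
  initial_deriv : v 0 = v₀

theorem IsIntegratedSolution.mono {v g η : ℝ → H}
    (h : IsIntegratedSolution T Ψ B f u₀ v₀ u v g η) (hST : S ≤ T) :
    IsIntegratedSolution S Ψ B f u₀ v₀ u v g η :=
  ⟨h.primitive.mono hST, h.primitive_deriv.mono hST, ae_intervalMeasure_mono hST h.equation,
    ae_intervalMeasure_mono hST h.mem_subdiff, h.initial, h.initial_deriv⟩

theorem IsStrongSolution.exists_integrated [CompleteSpace H] (hS : 0 < S)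
    (h : IsStrongSolution S Ψ B f u₀ v₀ u) :
    ∃ v g η, IsIntegratedSolution S Ψ B f u₀ v₀ u v g η := by
  obtain ⟨v, g, η, hsob, huc, hvc, -, heq, hmem, h0, h1⟩ := h
  exact ⟨v, g, η, hsob.weakDeriv.isPrimitive hS huc
    (integrable_of_memLp hsob.memLp_deriv), hsob.weakDeriv_two.isPrimitive hS hvc
    (integrable_of_memLp hsob.memLp_deriv_two), heq, hmem, h0, h1⟩

theorem IsIntegratedSolution.isStrongSolution [CompleteSpace H] (hS : 0 ≤ S) {v g η : ℝ → H}
    (h : IsIntegratedSolution S Ψ B f u₀ v₀ u v g η) (hg : MemLp g 2 (intervalMeasure S))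
    (hη : AEStronglyMeasurable η (intervalMeasure S)) : IsStrongSolution S Ψ B f u₀ v₀ u := by
  refine ⟨v, g, hη.mk η, ⟨memLp_of_continuousOn h.primitive.continuousOn 2,
    memLp_of_continuousOn h.primitive_deriv.continuousOn 2, hg,
    h.primitive.hasWeakDeriv hS, h.primitive_deriv.hasWeakDeriv hS⟩, h.primitive.continuousOn,
    h.primitive_deriv.continuousOn, hη.stronglyMeasurable_mk, ?_, ?_, h.initial, h.initial_deriv⟩
  · filter_upwards [h.equation, hη.ae_eq_mk] with t h1 h2
    rwa [← h2]
  · filter_upwards [h.mem_subdiff, hη.ae_eq_mk] with t h1 h2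
    rwa [← h2]

/-- Continuous dependence on the data, with only the Lipschitz estimate of `B` between the two
solutions at hand. -/
theorem IsIntegratedSolution.norm_sub_sq_le [CompleteSpace H] (hΨ : IsDissipationPotential Ψ)
    {u₁ v₁ g₁ η₁ u₂ v₂ g₂ η₂ f₁ f₂ : ℝ → H} {a₁ b₁ a₂ b₂ : H}
    (h₁ : IsIntegratedSolution S Ψ B f₁ a₁ b₁ u₁ v₁ g₁ η₁)
    (h₂ : IsIntegratedSolution S Ψ B f₂ a₂ b₂ u₂ v₂ g₂ η₂)
    (hf : MemLp (fun t => f₁ t - f₂ t) 2 (intervalMeasure S)) {α : ℝ → ℝ}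
    (hα : Integrable α (intervalMeasure S)) (hα0 : ∀ᵐ t ∂(intervalMeasure S), 0 ≤ α t)
    (hB : ∀ᵐ t ∂(intervalMeasure S), ‖B t (u₁ t) - B t (u₂ t)‖ ≤ α t * ‖u₁ t - u₂ t‖)
    {t : ℝ} (ht : t ∈ Icc 0 S) :
    ‖u₁ t - u₂ t‖ ^ 2 ≤ Real.exp (2 * S) * Real.exp (∫ s in Ioo 0 S, α s) *
      (‖a₁ - a₂‖ ^ 2 + ‖b₁ - b₂‖ ^ 2 + ∫ s in Ioo 0 S, ‖f₁ s - f₂ s‖ ^ 2) := by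
  have hS : 0 ≤ S := ht.1.trans ht.2
  have h0S : (0 : ℝ) ∈ Icc 0 S := ⟨le_rfl, hS⟩
  have hSS : S ∈ Icc 0 S := ⟨hS, le_rfl⟩
  have hu := (h₁.primitive.sub h₂.primitive).normSq
  have hv := (h₁.primitive_deriv.sub h₂.primitive_deriv).normSq
  set y : ℝ → ℝ := fun t => ‖u₁ t - u₂ t‖ ^ 2 + ‖v₁ t - v₂ t‖ ^ 2 with hy
  have hyc : ContinuousOn y (Icc 0 S) := hu.continuousOn.add hv.continuousOn
  have hk : Integrable (fun t => 2 + α t) (intervalMeasure S) := (integrable_const 2).add hα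
  have hk0 : ∀ᵐ t ∂(intervalMeasure S), 0 ≤ 2 + α t := hα0.mono fun t ht => by linarith
  have hfi := integrable_normSq hf
  set c := ‖a₁ - a₂‖ ^ 2 + ‖b₁ - b₂‖ ^ 2 + ∫ s in 0..S, ‖f₁ s - f₂ s‖ ^ 2 with hc
  have hc0 : 0 ≤ c := add_nonneg (by positivity)
    (intervalIntegral_nonneg_of_ae hSS hfi (ae_of_all _ fun s => by positivity))
  have hmain : ∀ t ∈ Icc 0 S, y t ≤ c + ∫ s in 0..t, (2 + α s) * y s := by
    intro t ht
    have e1 : ‖u₁ t - u₂ t‖ ^ 2 = ‖u₁ 0 - u₂ 0‖ ^ 2 + _ := hu.2 t ht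
    have e2 : ‖v₁ t - v₂ t‖ ^ 2 = ‖v₁ 0 - v₂ 0‖ ^ 2 + _ := hv.2 t ht
    rw [h₁.initial, h₂.initial] at e1
    rw [h₁.initial_deriv, h₂.initial_deriv] at e2
    have hky := integrable_mul_continuousOn hk hyc
    have e3 : (∫ s in 0..t, 2 * inner ℝ (u₁ s - u₂ s) (v₁ s - v₂ s)) +
        (∫ s in 0..t, 2 * inner ℝ (v₁ s - v₂ s) (g₁ s - g₂ s)) ≤
        (∫ s in 0..t, (2 + α s) * y s) + ∫ s in 0..t, ‖f₁ s - f₂ s‖ ^ 2 := by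
      rw [← intervalIntegral.integral_add (hu.intervalIntegrable h0S ht)
        (hv.intervalIntegrable h0S ht), ← intervalIntegral.integral_add
        (intervalIntegrable_of_integrable hky h0S ht)
        (intervalIntegrable_of_integrable hfi h0S ht)]
      refine intervalIntegral_mono_of_ae le_rfl ht.1 ht.2 (hu.1.add hv.1) (hky.add hfi) ?_
      filter_upwards [h₁.equation, h₂.equation, h₁.mem_subdiff, h₂.mem_subdiff, hB, hα0]
        with s q1 q2 m1 m2 hBs hαs
      have hmon := hΨ.inner_sub_nonneg m1 m2
      have e : g₁ s - g₂ s = (f₁ s - f₂ s) - (B s (u₁ s) - B s (u₂ s)) - (η₁ s - η₂ s) := by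
        rw [← q1, ← q2]
        abel
      show _ ≤ (2 + α s) * (‖u₁ s - u₂ s‖ ^ 2 + ‖v₁ s - v₂ s‖ ^ 2) + ‖f₁ s - f₂ s‖ ^ 2
      simp only [e]
      rw [inner_sub_right (v₁ s - v₂ s) _ (η₁ s - η₂ s),
        inner_sub_right (v₁ s - v₂ s) (f₁ s - f₂ s),
        real_inner_comm (η₁ s - η₂ s) (v₁ s - v₂ s)]
      have i1 := real_inner_le_norm (u₁ s - u₂ s) (v₁ s - v₂ s)
      have i2 := real_inner_le_norm (v₁ s - v₂ s) (f₁ s - f₂ s)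
      have i3 := neg_le_of_abs_le (abs_real_inner_le_norm (v₁ s - v₂ s)
        (B s (u₁ s) - B s (u₂ s)))
      have i4 := mul_le_mul_of_nonneg_left hBs (norm_nonneg (v₁ s - v₂ s))
      set p := ‖u₁ s - u₂ s‖
      set q := ‖v₁ s - v₂ s‖
      set r := ‖f₁ s - f₂ s‖
      -- `2 p q ≤ p² + q²` is used twice, the second time with the factor `α`
      have j1 : 0 ≤ (p - q) ^ 2 := by positivity
      have j2 : 0 ≤ (q - r) ^ 2 := by positivity
      have j3 := mul_nonneg hαs j1
      have j4 : 0 ≤ p ^ 2 := by positivity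
      nlinarith
    have e4 := intervalIntegral_mono_right ht.1 ht.2 le_rfl hfi
      (ae_of_all _ fun s => by positivity)
    show ‖u₁ t - u₂ t‖ ^ 2 + ‖v₁ t - v₂ t‖ ^ 2 ≤ _
    linarith
  have hgr := le_mul_exp_of_le_add_integral_mul hk hk0 hyc hmain t ht
  have hmono := intervalIntegral_mono_right ht.1 ht.2 le_rfl hk hk0
  rw [intervalIntegral.integral_add (a := 0) (b := S) (by simp)
    (intervalIntegrable_of_integrable hα h0S hSS), intervalIntegral.integral_const, sub_zero,
    smul_eq_mul, mul_comm S] at hmono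
  have hle : ‖u₁ t - u₂ t‖ ^ 2 ≤ y t := le_add_of_nonneg_right (by positivity)
  rw [← Real.exp_add, ← intervalIntegral_eq_setIntegral_Ioo hS,
    ← intervalIntegral_eq_setIntegral_Ioo hS, mul_comm]
  exact hle.trans (hgr.trans (mul_le_mul_of_nonneg_left (Real.exp_le_exp.2 hmono) hc0))

/-- Global solvability when `B` is globally Lipschitz: `u ↦ u₀ + ∫ v`, where `v` solves
`v' + ∂Ψ(v) ∋ f - B(·, u)`, is a map of Volterra type. -/
theorem exists_integratedSolution [CompleteSpace H] (hΨ : IsDissipationPotential Ψ) (hT : 0 ≤ T)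
    {α b : ℝ → ℝ} (hα : MemLp α 2 (intervalMeasure T))
    (hB : ∀ᵐ t ∂(intervalMeasure T), ∀ x y : H, ‖B t x - B t y‖ ≤ α t * ‖x - y‖)
    (hb : MemLp b 2 (intervalMeasure T)) (hB0 : ∀ᵐ t ∂(intervalMeasure T), ‖B t 0‖ ≤ b t)
    (hmeas : ∀ v : ℝ → H, AEStronglyMeasurable v (intervalMeasure T) →
      AEStronglyMeasurable (fun t => B t (v t)) (intervalMeasure T))
    (u₀ : H) (hv₀ : v₀ ∈ effDomain Ψ) (hf : MemLp f 2 (intervalMeasure T)) :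
    ∃ u v g η, IsIntegratedSolution T Ψ B f u₀ v₀ u v g η ∧ MemLp g 2 (intervalMeasure T) ∧
      AEStronglyMeasurable η (intervalMeasure T) := by
  have h0T : (0 : ℝ) ∈ Icc 0 T := ⟨le_rfl, hT⟩
  obtain ⟨ξ₀, hξ₀⟩ := hΨ.subdiff_zero
  have hBm : ∀ u : ℝ → H, ContinuousOn u (Icc 0 T) →
      MemLp (fun t => B t (u t)) 2 (intervalMeasure T) :=
    fun u hu => memLp_comp_of_lipschitz hα hB hb hB0 hmeas hu
  have hhm : ∀ u : ℝ → H, ContinuousOn u (Icc 0 T) →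
      MemLp (fun t => f t - ξ₀ - B t (u t)) 2 (intervalMeasure T) :=
    fun u hu => (hf.sub (memLp_const ξ₀)).sub (hBm u hu)
  have hex : ∀ u : ℝ → H, ∃ v η : ℝ → H, ContinuousOn u (Icc 0 T) → v 0 = v₀ ∧
      MemLp η 2 (intervalMeasure T) ∧ IsPrimitive T v (fun t => f t - ξ₀ - B t (u t) - η t) ∧
      ∀ᵐ t ∂(intervalMeasure T), η t ∈ realSubdiff (effDomain Ψ) (normalised Ψ ξ₀) (v t) := by
    intro u
    by_cases hu : ContinuousOn u (Icc 0 T)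
    · obtain ⟨v, η, h⟩ := (hΨ.convexPotential hξ₀).exists_solution hT hv₀ (hhm u hu)
      exact ⟨v, η, fun _ => h⟩
    · exact ⟨0, 0, fun h => (hu h).elim⟩
  choose V E hVE using hex
  have hVi : ∀ u, ContinuousOn u (Icc 0 T) → Integrable (V u) (intervalMeasure T) := fun u hu =>
    (memLp_of_continuousOn (hVE u hu).2.2.1.continuousOn 1).integrable le_rfl
  have hαsq : Integrable (fun t => α t ^ 2) (intervalMeasure T) := hα.integrable_sq
  obtain ⟨u, huc, hu⟩ := exists_fixedPoint_of_volterra (S := T) (E := H)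
    (k := fun t => T * (T * Real.exp T) * α t ^ 2) (hαsq.const_mul _)
    (ae_of_all _ fun _ => by positivity) hT (fun u t => u₀ + ∫ s in 0..t, V u s)
    (fun u hu => (IsPrimitive.of_integrable (hVi u hu) u₀).continuousOn)
    (fun u w hu hw t ht => by
      have h0t : (0 : ℝ) ∈ Icc 0 t := ⟨le_rfl, ht.1⟩
      have htt : t ∈ Icc 0 t := ⟨ht.1, le_rfl⟩
      have hd : MemLp (fun s => V u s - V w s) 2 (intervalMeasure T) :=
        memLp_of_continuousOn ((hVE u hu).2.2.1.continuousOn.sub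
          (hVE w hw).2.2.1.continuousOn) 2
      have hαd : Integrable (fun s => α s ^ 2 * ‖u s - w s‖ ^ 2) (intervalMeasure T) :=
        integrable_mul_continuousOn hαsq ((hu.sub hw).norm.pow 2)
      have hαd0 : 0 ≤ ∫ s in 0..t, α s ^ 2 * ‖u s - w s‖ ^ 2 :=
        intervalIntegral_nonneg_of_ae ht hαd (ae_of_all _ fun s => by positivity)
      have hhd : MemLp (fun s => f s - ξ₀ - B s (u s) - (f s - ξ₀ - B s (w s))) 2
        (intervalMeasure T) := (hhm u hu).sub (hhm w hw)
      have hpt : ∀ s ∈ Icc 0 t, ‖V u s - V w s‖ ^ 2 ≤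
          Real.exp T * ∫ s in 0..t, α s ^ 2 * ‖u s - w s‖ ^ 2 := by
        intro s hs
        have hsT : s ∈ Icc 0 T := ⟨hs.1, hs.2.trans ht.2⟩
        refine (norm_sub_sq_le_of_first_order (hVE u hu).2.2.1 (hVE w hw).2.2.1
          ((hVE u hu).1.trans (hVE w hw).1.symm) (hVE u hu).2.2.2 (hVE w hw).2.2.2
          hhd hsT).trans (mul_le_mul_of_nonneg_left ?_ (Real.exp_pos T).le)
        refine (intervalIntegral_mono_of_ae le_rfl hs.1 hsT.2 (integrable_normSq hhd) hαd ?_).trans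
          (intervalIntegral_mono_right hs.1 hs.2 ht.2 hαd (ae_of_all _ fun s => by positivity))
        filter_upwards [hB] with r hr
        rw [sub_sub_sub_cancel_left, norm_sub_rev, ← mul_pow]
        exact pow_le_pow_left₀ (norm_nonneg _) (hr _ _) 2
      rw [add_sub_add_left_eq_sub, ← intervalIntegral.integral_sub
        (intervalIntegrable_of_integrable (hVi u hu) h0T ht)
        (intervalIntegrable_of_integrable (hVi w hw) h0T ht)]
      refine (norm_intervalIntegral_sq_le hd ht).trans ?_
      have h1 : ∫ s in 0..t, ‖V u s - V w s‖ ^ 2 ≤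
          ∫ s in 0..t, Real.exp T * ∫ s in 0..t, α s ^ 2 * ‖u s - w s‖ ^ 2 := by
        refine intervalIntegral_mono_of_ae le_rfl ht.1 le_rfl
          (integrable_normSq (memLp_intervalMeasure_mono ht.2 hd)) (integrable_const _) ?_
        filter_upwards [ae_restrict_mem measurableSet_Ioo] with s hs
        exact hpt s (Ioo_subset_Icc_self hs)
      rw [intervalIntegral.integral_const, sub_zero, smul_eq_mul] at h1
      simp only [mul_assoc (T * (T * Real.exp T))]
      rw [intervalIntegral.integral_const_mul]
      have hIe : 0 ≤ Real.exp T * ∫ s in 0..t, α s ^ 2 * ‖u s - w s‖ ^ 2 :=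
        mul_nonneg (Real.exp_pos T).le hαd0
      calc t * ∫ s in 0..t, ‖V u s - V w s‖ ^ 2
          ≤ t * (t * (Real.exp T * ∫ s in 0..t, α s ^ 2 * ‖u s - w s‖ ^ 2)) :=
            mul_le_mul_of_nonneg_left h1 ht.1
        _ ≤ T * (T * (Real.exp T * ∫ s in 0..t, α s ^ 2 * ‖u s - w s‖ ^ 2)) := by
            have := ht.1
            have := ht.2
            gcongr
        _ = T * (T * Real.exp T) * ∫ s in 0..t, α s ^ 2 * ‖u s - w s‖ ^ 2 := by ring)
  obtain ⟨hv0, hEm, hVp, hEs⟩ := hVE u huc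
  have hu0 : u 0 = u₀ := by
    rw [← hu 0 h0T]
    simp
  refine ⟨u, V u, fun t => f t - ξ₀ - B t (u t) - E u t, fun t => E u t + ξ₀,
    ⟨⟨hVi u huc, fun t ht => by rw [hu0, ← hu t ht]⟩, hVp, ae_of_all _ fun t => by abel, ?_, hu0,
      hv0⟩, (hhm u huc).sub hEm, (hEm.add (memLp_const ξ₀)).1⟩
  exact hEs.mono fun t ht => hΨ.add_mem_subdiff ht

/-- Local solvability, by truncating `B` outside a ball containing `u₀` in its interior. -/
theorem exists_local_strongSolution [CompleteSpace H] (hΨ : IsDissipationPotential Ψ) (hT : 0 < T)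
    (hB : IsLocallyLipschitz T B) (u₀ : H) (hv₀ : v₀ ∈ effDomain Ψ)
    (hf : MemLp f 2 (intervalMeasure T)) :
    ∃ S : ℝ, 0 < S ∧ S ≤ T ∧ ∃ u : ℝ → H, IsStrongSolution S Ψ B f u₀ v₀ u := by
  set R := ‖u₀‖ + 1 with hR
  have hR0 : 0 < R := by positivity
  obtain ⟨P, hPL, hPR, hPx⟩ := exists_ball_projection (H := H) hR0.le
  obtain ⟨α, hα, hα0, hαB⟩ := hB.lipschitz R hR0
  obtain ⟨b, hb, -, hb0⟩ := hB.bound_zero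
  have hP0 : P 0 = 0 := hPx 0 (Metric.mem_closedBall_self hR0.le)
  obtain ⟨u, v, g, η, hsol, hg, hη⟩ := exists_integratedSolution (B := fun t x => B t (P x)) hΨ
    hT.le hα (by
      filter_upwards [hα0, hαB] with t h0 h1 x y
      refine (h1 _ (hPR x) _ (hPR y)).trans (mul_le_mul_of_nonneg_left ?_ h0)
      simpa [dist_eq_norm] using hPL.dist_le_mul x y) hb (by simpa only [hP0] using hb0)
    (fun v hv => hB.measurable_comp _ (hPL.continuous.comp_aestronglyMeasurable hv)) u₀ hv₀ hf
  have hcont := hsol.primitive.continuousOn 0 ⟨le_rfl, hT.le⟩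
  have hnear : ∀ᶠ t in nhdsWithin 0 (Icc 0 T), ‖u t‖ < R := by
    refine hcont.norm.eventually_lt_const ?_
    show ‖u 0‖ < R
    rw [hsol.initial]
    exact lt_add_one _
  obtain ⟨ε, hε, hball⟩ := Metric.mem_nhdsWithin_iff.1 hnear
  set S := min (ε / 2) T with hS
  have hS0 : 0 < S := lt_min (half_pos hε) hT
  have hST : S ≤ T := min_le_right _ _
  have hsmall : ∀ t ∈ Icc 0 S, P (u t) = u t := fun t ht => by
    refine hPx _ ?_
    rw [mem_closedBall_zero_iff]
    refine le_of_lt (hball ⟨?_, ht.1, ht.2.trans hST⟩)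
    rw [Metric.mem_ball, Real.dist_eq, sub_zero, abs_of_nonneg ht.1]
    exact (ht.2.trans (min_le_left _ _)).trans_lt (half_lt_self hε)
  have hS' := hsol.mono hST
  refine ⟨S, hS0, hST, u, IsIntegratedSolution.isStrongSolution hS0.le
    { hS' with
      equation := ?_ } (memLp_intervalMeasure_mono hST hg)
    (hη.mono_measure (Measure.restrict_mono (Ioo_subset_Ioo_right hST) le_rfl))⟩
  filter_upwards [hS'.equation, ae_restrict_mem measurableSet_Ioo] with t ht hts
  rwa [hsmall t (Ioo_subset_Icc_self hts)] at ht

theorem strongSolution_unique [CompleteSpace H] (hΨ : IsDissipationPotential Ψ)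
    (hB : IsLocallyLipschitz T B) (hS : 0 < S) (hST : S ≤ T) {w : ℝ → H}
    (hu : IsStrongSolution S Ψ B f u₀ v₀ u) (hw : IsStrongSolution S Ψ B f u₀ v₀ w) :
    EqOn u w (Icc 0 S) := by
  obtain ⟨v₁, g₁, η₁, h₁⟩ := hu.exists_integrated hS
  obtain ⟨v₂, g₂, η₂, h₂⟩ := hw.exists_integrated hS
  obtain ⟨C₁, hC₁⟩ := isCompact_Icc.exists_bound_of_continuousOn h₁.primitive.continuousOn
  obtain ⟨C₂, hC₂⟩ := isCompact_Icc.exists_bound_of_continuousOn h₂.primitive.continuousOn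
  obtain ⟨α, hα, hα0, hαB⟩ := hB.lipschitz (max 1 (max C₁ C₂)) (by positivity)
  intro t ht
  have key := h₁.norm_sub_sq_le hΨ h₂ (by simp)
    (integrable_of_memLp (memLp_intervalMeasure_mono hST hα))
    (ae_intervalMeasure_mono hST hα0) (by
      filter_upwards [ae_intervalMeasure_mono hST hαB, ae_restrict_mem measurableSet_Ioo]
        with s hs hsS
      have hsI := Ioo_subset_Icc_self hsS
      refine hs _ ?_ _ ?_ <;> rw [mem_closedBall_zero_iff]
      · exact (hC₁ s hsI).trans ((le_max_left _ _).trans (le_max_right _ _))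
      · exact (hC₂ s hsI).trans ((le_max_right _ _).trans (le_max_right _ _))) ht
  simp only [sub_self, norm_zero, ne_eq, OfNat.ofNat_ne_zero, not_false_eq_true, zero_pow,
    add_zero, integral_zero, mul_zero] at key
  exact sub_eq_zero.1 (norm_eq_zero.1 (sq_eq_zero_iff.1 (le_antisymm key (by positivity))))

end SecondOrder

end SecondOrderInclusion

theorem theorem2p1 {H : Type*} [NormedAddCommGroup H] [InnerProductSpace ℝ H] [CompleteSpace H]
    [TopologicalSpace.SeparableSpace H] (T : ℝ) (hT : 0 < T) :
    -- the constant of the stability estimate depends on `T` only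
    ∃ M : ℝ, 0 < M ∧
    ∀ (Ψ : H → EReal) (B : ℝ → H → H),
      SecondOrderInclusion.IsDissipationPotential Ψ →
      SecondOrderInclusion.IsLocallyLipschitz T B →
      -- existence and uniqueness of local solutions
      (∀ u₀ v₀ : H,
        v₀ ∈ closure (SecondOrderInclusion.subdiffDomain Ψ) ∩ SecondOrderInclusion.effDomain Ψ →
        ∀ f : ℝ → H, MemLp f 2 (SecondOrderInclusion.intervalMeasure T) →
          (∃ S : ℝ, 0 < S ∧ S ≤ T ∧
            ∃ u : ℝ → H, SecondOrderInclusion.IsStrongSolution S Ψ B f u₀ v₀ u) ∧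
          (∀ S : ℝ, 0 < S → S ≤ T → ∀ u w : ℝ → H,
            SecondOrderInclusion.IsStrongSolution S Ψ B f u₀ v₀ u →
            SecondOrderInclusion.IsStrongSolution S Ψ B f u₀ v₀ w → EqOn u w (Icc 0 S))) ∧
      -- the globally Lipschitz case
      (∀ α : ℝ → ℝ, SecondOrderInclusion.IsGloballyLipschitz T B α →
        -- existence and uniqueness of global solutions
        (∀ u₀ v₀ : H,
          v₀ ∈ closure (SecondOrderInclusion.subdiffDomain Ψ) ∩ SecondOrderInclusion.effDomain Ψ →
          ∀ f : ℝ → H, MemLp f 2 (SecondOrderInclusion.intervalMeasure T) →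
            ∃ u : ℝ → H, SecondOrderInclusion.IsStrongSolution T Ψ B f u₀ v₀ u ∧
              ∀ w : ℝ → H, SecondOrderInclusion.IsStrongSolution T Ψ B f u₀ v₀ w →
                EqOn w u (Icc 0 T)) ∧
        -- continuous dependence on the data
        (∀ (f g : ℝ → H) (u₀₁ u₀₂ v₀₁ v₀₂ : H) (u₁ u₂ : ℝ → H),
          MemLp f 2 (SecondOrderInclusion.intervalMeasure T) →
          MemLp g 2 (SecondOrderInclusion.intervalMeasure T) →
          v₀₁ ∈ closure (SecondOrderInclusion.subdiffDomain Ψ) ∩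
            SecondOrderInclusion.effDomain Ψ →
          v₀₂ ∈ closure (SecondOrderInclusion.subdiffDomain Ψ) ∩
            SecondOrderInclusion.effDomain Ψ →
          SecondOrderInclusion.IsStrongSolution T Ψ B f u₀₁ v₀₁ u₁ →
          SecondOrderInclusion.IsStrongSolution T Ψ B g u₀₂ v₀₂ u₂ →
          ∀ t ∈ Icc 0 T, ‖u₁ t - u₂ t‖ ^ 2 ≤
            M * Real.exp (∫ s in Ioo 0 T, α s) *
              (‖u₀₁ - u₀₂‖ ^ 2 + ‖v₀₁ - v₀₂‖ ^ 2 +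
                ∫ s in Ioo 0 T, ‖f s - g s‖ ^ 2))) := by
  refine ⟨Real.exp (2 * T), Real.exp_pos _, fun Ψ B hΨ hB => ⟨fun u₀ v₀ hv₀ f hf =>
    ⟨SecondOrderInclusion.exists_local_strongSolution hΨ hT hB u₀ hv₀.2 hf,
      fun S hS hST u w hu hw => SecondOrderInclusion.strongSolution_unique hΨ hB hS hST hu hw⟩,
    fun α hα => ⟨fun u₀ v₀ hv₀ f hf => ?_, ?_⟩⟩⟩
  · obtain ⟨b, hb, -, hb0⟩ := hB.bound_zero
    obtain ⟨u, v, g, η, hsol, hg, hη⟩ := SecondOrderInclusion.exists_integratedSolution hΨ hT.le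
      hα.1 hα.2 hb hb0 hB.measurable_comp u₀ hv₀.2 hf
    have hu := hsol.isStrongSolution hT.le hg hη
    exact ⟨u, hu, fun w hw =>
      SecondOrderInclusion.strongSolution_unique hΨ hB hT le_rfl hw hu⟩
  · intro f g a₁ a₂ b₁ b₂ u₁ u₂ hf hg _ _ h₁ h₂ t ht
    rcases subsingleton_or_nontrivial H with hH | hH
    · rw [Subsingleton.elim (u₁ t) (u₂ t), sub_self, norm_zero, zero_pow two_ne_zero]
      have : 0 ≤ ∫ s in Ioo 0 T, ‖f s - g s‖ ^ 2 :=
        integral_nonneg fun s => by positivity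
      positivity
    · obtain ⟨v₁, g₁, η₁, hi₁⟩ := h₁.exists_integrated hT
      obtain ⟨v₂, g₂, η₂, hi₂⟩ := h₂.exists_integrated hT
      exact hi₁.norm_sub_sq_le hΨ hi₂ (hf.sub hg)
        (SecondOrderInclusion.integrable_of_memLp hα.1) hα.ae_nonneg
        (hα.2.mono fun s hs => hs _ _) ht
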